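/- Let $B=(B_t)_{t\ge 0}$ be a one-dimensional Brownian motion on a complete probability space $(\Omega,\mathcal F,\mathbb P)$ and let $\mathcal F_t$ be the $\sigma$-algebra generated by $(B_s)_{s\le t}$ and the $\mathbb P$-null sets. Let $\mu,r\in\mathbb R$, $\sigma>0$, $\tau>0$, $\gamma>0$, $\alpha\in(0,1)$, $k\ge 0$, $\delta>0$ be constants such that $$\phi:=\frac{\mu-r}{\sigma}\neq 0,\qquad \delta>h:=r\alpha+\frac{\alpha\phi^2}{2(1-\alpha)}.$$ Put $Z_\tau:=\exp\left(-\phi B_\tau-(r+\phi^2/2)\tau\right)$, let $\mathcal Y$ be the set of $\mathcal F_\tau$-measurable random variables $Y\ge 0$ with $\mathbb E[Z_\tau Y]\le 1$, and define $U(x):=x^\alpha$ for $x\ge 0$, $U(x):=-k|x|^\alpha$ for $x<0$, and $$F(y;\theta):=U(y-\gamma)+\theta y^\alpha,\qquad \Phi(\theta):=\sup_{Y\in\mathcal Y}\mathbb E[F(Y;\theta)],\qquad \underline\theta:=-\left(1+k^{\frac1{1-\alpha}}\right)^{1-\alpha}.$$ For $\kappa\in[0,1]$ let $\theta^*(\kappa)$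 be the unique real number with $\theta^*(\kappa)=e^{-\delta\tau}\Phi(\kappa\theta^*(\kappa))$. Fix $\beta\in(0,1)$; for $\xi\in[0,e^{h\tau}]$ put $\kappa(\xi):=\dfrac{\beta}{1-(1-\beta)e^{-\delta\tau}\xi}$ and $$G(\xi):=\left\{\mathbb E[Y^\alpha]\;:\;Y\in\operatorname*{arg\,max}_{Y\in\mathcal Y}\mathbb E\left[F\left(Y;\kappa(\xi)\theta^*(\kappa(\xi))\right)\right]\right\}.$$ Let $\hat\xi\in[0,e^{h\tau}]$ be any fixed point of $G$, i.e. $\hat\xi\in G(\hat\xi)$, and set $$A_{\mathrm{my}}:=\theta^*(0),\qquad A_{\mathrm{expo}}:=\theta^*(1),\qquad A_{\mathrm{so}}:=\kappa(\hat\xi)\,\theta^*(\kappa(\hat\xi)),$$ and, when $A_{\mathrm{my}}\ne 0$, $\hat\beta:=A_{\mathrm{so}}/A_{\mathrm{expo}}$. Then: 1. If $A_{\mathrm{my}}=0$, then $\beta A_{\mathrm{expo}}=A_{\mathrm{expo}}=A_{\mathrm{so}}=0$. 2. If $A_{\mathrm{my}}>0$, then $0<A_{\mathrm{so}}<\beta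 A_{\mathrm{expo}}<A_{\mathrm{expo}}$; in particular $\hat\beta\in(0,\beta)$. 3. If $A_{\mathrm{my}}<0$, then $A_{\mathrm{expo}}<A_{\mathrm{so}}\le\beta A_{\mathrm{expo}}<0$; in particular $\hat\beta\in[\beta,1)$. If moreover $A_{\mathrm{expo}}\ge\underline\theta$, then $A_{\mathrm{so}}<\beta A_{\mathrm{expo}}$ and $\hat\beta>\beta$. -/

import Mathlib

open MeasureTheory ProbabilityTheory
open scoped NNReal ENNReal

namespace PeriodicPortfolio

/-- The numerical parameters of the model: drift `μ` and volatility `σ` of the risky asset, the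
risk-free rate `r`, the length `τ` of an evaluation period, the benchmark `γ`, the utility
parameters `α` and `k`, and the discount rate `δ`. -/
structure Params where
  μ : ℝ
  r : ℝ
  σ : ℝ
  τ : ℝ≥0
  γ : ℝ
  α : ℝ
  k : ℝ
  δ : ℝ

namespace Params

noncomputable section

/-- The market price of risk. -/
def φ (p : Params) : ℝ := (p.μ - p.r) / p.σ

/-- The growth constant of the one-period Merton problem. -/
def h (p : Params) : ℝ := p.r * p.α + p.α * p.φ ^ 2 / (2 * (1 - p.α))

/-- The standing assumptions on the parameters. -/
structure Standing (p : Params) : Prop where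
  σ_pos : 0 < p.σ
  φ_ne_zero : p.φ ≠ 0
  τ_pos : 0 < p.τ
  γ_pos : 0 < p.γ
  α_pos : 0 < p.α
  α_lt_one : p.α < 1
  k_nonneg : 0 ≤ p.k
  δ_pos : 0 < p.δ
  h_lt_δ : p.h < p.δ

/-- The piecewise power utility function. -/
def U (p : Params) (x : ℝ) : ℝ := if 0 ≤ x then x ^ p.α else -p.k * |x| ^ p.α

/-- The effective utility `F(y; θ) = U(y - γ) + θ y ^ α`. -/
def F (p : Params) (y θ : ℝ) : ℝ := p.U (y - p.γ) + θ * y ^ p.α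

/-- The threshold `-(1 + k ^ (1 / (1 - α))) ^ (1 - α)`. -/
def thetaLow (p : Params) : ℝ := -(1 + p.k ^ (1 / (1 - p.α))) ^ (1 - p.α)

end

end Params

noncomputable section

variable {Ω : Type*} [MeasurableSpace Ω]

/-- The σ-algebra at time `t` of the augmented filtration of `B`: it is generated by the `B s`
with `s ≤ t` and the `P`-null sets. -/
abbrev augmentedSigma (P : Measure Ω) (B : ℝ≥0 → Ω → ℝ) (t : ℝ≥0) : MeasurableSpace Ω :=
  (⨆ s : Set.Iic t, MeasurableSpace.comap (B s) inferInstance) ⊔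
    MeasurableSpace.generateFrom {N : Set Ω | P N = 0}

/-- The pricing kernel of the Black-Scholes market driven by `B`. -/
def kernelZ (p : Params) (B : ℝ≥0 → Ω → ℝ) (t : ℝ≥0) (ω : Ω) : ℝ :=
  Real.exp (-p.φ * B t ω - (p.r + p.φ ^ 2 / 2) * t)

/-- The admissible one-period gross returns: the nonnegative random variables `Y`, measurable with
respect to the information at time `τ`, with `E[Z_τ Y] ≤ 1` (an expectation in `[0, ∞]`). -/
def returns (p : Params) (P : Measure Ω) (B : ℝ≥0 → Ω → ℝ) : Set (Ω → ℝ) :=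
  {Y | Measurable[augmentedSigma P B p.τ] Y ∧ (∀ ω, 0 ≤ Y ω) ∧
    ∫⁻ ω, ENNReal.ofReal (kernelZ p B p.τ ω * Y ω) ∂P ≤ 1}

/-- The objective `E[F(Y; θ)]`. -/
def objective (p : Params) (P : Measure Ω) (θ : ℝ) (Y : Ω → ℝ) : ℝ :=
  ∫ ω, p.F (Y ω) θ ∂P

/-- The value `Φ(θ) = sup_Y E[F(Y; θ)]` over the admissible gross returns. -/
def Phi (p : Params) (P : Measure Ω) (B : ℝ≥0 → Ω → ℝ) (θ : ℝ) : ℝ :=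
  sSup (objective p P θ '' returns p P B)

/-- The maximizers of `E[F(Y; θ)]` over the admissible gross returns. -/
def argmaxSet (p : Params) (P : Measure Ω) (B : ℝ≥0 → Ω → ℝ) (θ : ℝ) : Set (Ω → ℝ) :=
  {Y ∈ returns p P B | IsMaxOn (objective p P θ) (returns p P B) Y}

/-- The number `θ*(κ)`, for `κ ∈ [0, 1]`: the (unique) fixed point of `θ ↦ e ^ (-δτ) Φ(κ θ)`. -/
def thetaStar (p : Params) (P : Measure Ω) (B : ℝ≥0 → Ω → ℝ) (κ : ℝ) : ℝ :=
  Classical.epsilon fun θ : ℝ =>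
    Function.IsFixedPt (fun x : ℝ => Real.exp (-p.δ * p.τ) * Phi p P B (κ * x)) θ

/-- The factor `β / (1 - (1 - β) e ^ (-δτ) ξ)`. -/
def kappa (p : Params) (β ξ : ℝ) : ℝ := β / (1 - (1 - β) * Real.exp (-p.δ * p.τ) * ξ)

/-- The set-valued map `G`: the values `E[Y ^ α]` of the maximizers `Y` of
`E[F(Y; κ θ*(κ))]`, where `κ = β / (1 - (1 - β) e ^ (-δτ) ξ)`. -/
def mapG (p : Params) (P : Measure Ω) (B : ℝ≥0 → Ω → ℝ) (β ξ : ℝ) : Set ℝ :=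
  (fun Y : Ω → ℝ => ∫ ω, Y ω ^ p.α ∂P) ''
    argmaxSet p P B (kappa p β ξ * thetaStar p P B (kappa p β ξ))

/-- The constant of the completely myopic agent. -/
def Amy (p : Params) (P : Measure Ω) (B : ℝ≥0 → Ω → ℝ) : ℝ := thetaStar p P B 0

/-- The constant of the exponential discounter. -/
def Aexpo (p : Params) (P : Measure Ω) (B : ℝ≥0 → Ω → ℝ) : ℝ := thetaStar p P B 1

/-- The constant of the sophisticated agent with present bias `β`, for a given fixed point `ξ`
of `mapG`. -/
def Aso (p : Params) (P : Measure Ω) (B : ℝ≥0 → Ω → ℝ) (β ξ : ℝ) : ℝ :=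
  kappa p β ξ * thetaStar p P B (kappa p β ξ)

/-- The adjusted present bias `A_so / A_expo`. -/
def betaHat (p : Params) (P : Measure Ω) (B : ℝ≥0 → Ω → ℝ) (β ξ : ℝ) : ℝ :=
  Aso p P B β ξ / Aexpo p P B

end

end PeriodicPortfolio

namespace PeriodicPortfolio

/-! ### Integrability, the Merton bound and the value function. -/

section Market

variable {Ω : Type*} {B : ℝ≥0 → Ω → ℝ} {p : Params}

/-! Write `a = e^(-δτ)` and `A = A_so`. `Φ` is a supremum of functions affine in `θ` whose slopes
`E[Y^α]` lie in `[0, e^(hτ)]`. Since `δ > h`, the map `x ↦ x - aΦ(x)` is therefore strictly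
increasing; it vanishes at `A_expo`, so `x ≤ A_expo` iff `x ≤ aΦ(x)` (`le_Aexpo_iff`). The form of
`κ` turns `A = κaΦ(A)` into `A/β = a(Φ(A) + (A/β - A)ξ)` (`Aso_div_eq`). As `ξ = E[Y^α]` for a
maximizer `Y` at `A`, it is a subgradient of `Φ` at `A`; the right side is thus at most `aΦ(A/β)`,
and `A ≤ βA_expo`. The signs, and `A_expo < A` in the negative case, come from the same monotonicity
and `0 < κ < 1`.

For strictness, equality in the subgradient inequality would make one `Y` optimal at both `A` and
`A/β`. The two first-order conditions on `{Y > γ}` then force `Z` to be constant on a non-null set,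
although `Z` has no atoms (`eq_of_mem_argmaxSet`). That `{Y > γ}` is not null above `thetaLow` is
shown by moving wealth into very cheap states (`measure_gt_pos_of_mem_argmaxSet`). -/

lemma kernelZ_pos (t : ℝ≥0) (ω : Ω) : 0 < kernelZ p B t ω := Real.exp_pos _

/-- The random variable dual to the Merton problem. -/
noncomputable def mertonDual (p : Params) (B : ℝ≥0 → Ω → ℝ) (ω : Ω) : ℝ :=
  Real.exp (p.α / (1 - p.α) * (p.φ * B p.τ ω + (p.r + p.φ ^ 2 / 2) * p.τ - p.h * p.τ))

/-- Weighted AM-GM: `mertonDual` is chosen so that the weighted geometric mean with `e^(hτ) Z y` is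
exactly `y^α`. As `mertonDual` has mean `e^(hτ)`, integrating yields the Merton bound. -/
lemma rpow_le_mertonDual (hp : p.Standing) {y : ℝ} (hy : 0 ≤ y) (ω : Ω) :
    y ^ p.α ≤ p.α * Real.exp (p.h * p.τ) * (kernelZ p B p.τ ω * y)
      + (1 - p.α) * mertonDual p B ω := by
  have h1 : 0 < 1 - p.α := sub_pos.2 hp.α_lt_one
  have key := Real.geom_mean_le_arith_mean2_weighted (w₁ := p.α) (w₂ := 1 - p.α)
    (p₁ := Real.exp (p.h * p.τ) * kernelZ p B p.τ ω * y) (p₂ := mertonDual p B ω)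
    hp.α_pos.le h1.le (mul_nonneg (mul_pos (Real.exp_pos _) (kernelZ_pos _ _)).le hy)
    (Real.exp_pos _).le (by ring)
  have e : (Real.exp (p.h * p.τ) * kernelZ p B p.τ ω * y) ^ p.α
      * mertonDual p B ω ^ (1 - p.α) = y ^ p.α := by
    rw [Real.mul_rpow (mul_pos (Real.exp_pos _) (kernelZ_pos _ _)).le hy, kernelZ, mertonDual,
      ← Real.exp_add, ← Real.exp_mul, ← Real.exp_mul, mul_right_comm, ← Real.exp_add]
    have : (p.h * p.τ + (-p.φ * B p.τ ω - (p.r + p.φ ^ 2 / 2) * p.τ)) * p.α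
        + p.α / (1 - p.α) * (p.φ * B p.τ ω + (p.r + p.φ ^ 2 / 2) * p.τ - p.h * p.τ) * (1 - p.α)
        = 0 := by
      field_simp
      ring
    rw [this, Real.exp_zero, one_mul]
  rw [e] at key
  linarith

variable [MeasurableSpace Ω] {P : Measure Ω}

lemma measurable_brownian [P.IsComplete] (hB : IsBrownianReal B P) (t : ℝ≥0) :
    Measurable (B t) :=
  (hB.toIsPreBrownianReal.aemeasurable t).nullMeasurable.measurable_of_complete

lemma augmentedSigma_le [P.IsComplete] (hB : IsBrownianReal B P) (t : ℝ≥0) :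
    augmentedSigma P B t ≤ (inferInstance : MeasurableSpace Ω) := by
  refine sup_le (iSup_le fun s => (measurable_brownian hB s).comap_le) ?_
  exact MeasurableSpace.generateFrom_le fun N hN => Measure.IsComplete.out' N hN

lemma measurable_augmentedSigma (t : ℝ≥0) : Measurable[augmentedSigma P B t] (B t) := by
  have h : MeasurableSpace.comap (B t) inferInstance ≤ augmentedSigma P B t :=
    le_sup_of_le_left
      (le_iSup (fun s : Set.Iic t => MeasurableSpace.comap (B s) inferInstance) ⟨t, Set.mem_Iic.2 le_rfl⟩)
  exact measurable_iff_comap_le.2 h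

lemma kernelZ_measurable_augmentedSigma (t : ℝ≥0) :
    Measurable[augmentedSigma P B t] (kernelZ p B t) :=
  Real.measurable_exp.comp
    (((measurable_augmentedSigma t).const_mul _).sub_const _)

lemma measurable_kernelZ [P.IsComplete] (hB : IsBrownianReal B P) (t : ℝ≥0) :
    Measurable (kernelZ p B t) :=
  (kernelZ_measurable_augmentedSigma t).mono (augmentedSigma_le hB t) le_rfl

/-- Admissibility expressed through Bochner integrals. -/
lemma mem_returns_iff [P.IsComplete] (hB : IsBrownianReal B P) {Y : Ω → ℝ} :
    Y ∈ returns p P B ↔ Measurable[augmentedSigma P B p.τ] Y ∧ (∀ ω, 0 ≤ Y ω) ∧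
      Integrable (fun ω => kernelZ p B p.τ ω * Y ω) P ∧ ∫ ω, kernelZ p B p.τ ω * Y ω ∂P ≤ 1 := by
  refine and_congr_right fun hm => and_congr_right fun h0 => ?_
  have hm' : Measurable Y := hm.mono (augmentedSigma_le hB _) le_rfl
  have hZY : ∀ ω, 0 ≤ kernelZ p B p.τ ω * Y ω := fun ω => mul_nonneg (kernelZ_pos _ _).le (h0 ω)
  have hmeas : AEStronglyMeasurable (fun ω => kernelZ p B p.τ ω * Y ω) P :=
    ((measurable_kernelZ hB _).mul hm').aestronglyMeasurable
  constructor
  · intro h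
    have hi : Integrable (fun ω => kernelZ p B p.τ ω * Y ω) P :=
      ⟨hmeas, (hasFiniteIntegral_iff_ofReal (ae_of_all _ hZY)).2 (h.trans_lt ENNReal.one_lt_top)⟩
    refine ⟨hi, ?_⟩
    rw [← ofReal_integral_eq_lintegral_ofReal hi (ae_of_all _ hZY)] at h
    simpa using h
  · rintro ⟨hi, h⟩
    rw [← ofReal_integral_eq_lintegral_ofReal hi (ae_of_all _ hZY)]
    simpa using h

lemma measurable_of_mem_returns [P.IsComplete] (hB : IsBrownianReal B P) {Y : Ω → ℝ}
    (hY : Y ∈ returns p P B) : Measurable Y :=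
  hY.1.mono (augmentedSigma_le hB _) le_rfl

lemma zero_mem_returns : (fun _ => 0 : Ω → ℝ) ∈ returns p P B := by
  refine ⟨@measurable_const _ _ _ (_) _, fun _ => le_rfl, by simp⟩

lemma integrable_mertonDual (hB : IsBrownianReal B P) :
    Integrable (mertonDual p B) P := by
  have hl := hB.toIsPreBrownianReal.hasLaw_eval p.τ
  have h := integrable_exp_mul_gaussianReal (μ := 0) (v := p.τ) (p.α / (1 - p.α) * p.φ)
  rw [← hl.map_eq] at h
  have h2 := (h.comp_aemeasurable hl.aemeasurable).const_mul
    (Real.exp (p.α / (1 - p.α) * ((p.r + p.φ ^ 2 / 2) * p.τ - p.h * p.τ)))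
  refine h2.congr (ae_of_all _ fun ω => ?_)
  simp only [Function.comp, mertonDual, ← Real.exp_add]
  congr 1
  ring

lemma integral_mertonDual (hB : IsBrownianReal B P) (hp : p.Standing) :
    ∫ ω, mertonDual p B ω ∂P = Real.exp (p.h * p.τ) := by
  have hl := hB.toIsPreBrownianReal.hasLaw_eval p.τ
  have h := mgf_gaussianReal hl.map_eq (p.α / (1 - p.α) * p.φ)
  have h1 : 1 - p.α ≠ 0 := (sub_pos.2 hp.α_lt_one).ne'
  have e : mertonDual p B = fun ω =>
      Real.exp (p.α / (1 - p.α) * ((p.r + p.φ ^ 2 / 2) * p.τ - p.h * p.τ))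
        * Real.exp (p.α / (1 - p.α) * p.φ * B p.τ ω) := by
    ext ω
    rw [mertonDual, ← Real.exp_add]
    congr 1
    ring
  rw [e, integral_const_mul]
  rw [mgf] at h
  rw [h, ← Real.exp_add]
  congr 1
  rw [Params.h]
  field_simp
  ring

lemma integrable_rpow_of_mem_returns [P.IsComplete] (hB : IsBrownianReal B P) (hp : p.Standing)
    {Y : Ω → ℝ} (hY : Y ∈ returns p P B) : Integrable (fun ω => Y ω ^ p.α) P := by
  have h := (mem_returns_iff hB).1 hY
  refine Integrable.mono' ((h.2.2.1.const_mul (p.α * Real.exp (p.h * p.τ))).add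
    ((integrable_mertonDual (p := p) hB).const_mul (1 - p.α)))
    ((measurable_of_mem_returns hB hY).pow_const _).aestronglyMeasurable (ae_of_all _ fun ω => ?_)
  rw [Real.norm_of_nonneg (Real.rpow_nonneg (h.2.1 ω) _)]
  exact rpow_le_mertonDual hp (h.2.1 ω) ω

/-- The value of the Merton problem bounds `E[Y ^ α]`. -/
lemma integral_rpow_le [P.IsComplete] (hB : IsBrownianReal B P) (hp : p.Standing)
    {Y : Ω → ℝ} (hY : Y ∈ returns p P B) : ∫ ω, Y ω ^ p.α ∂P ≤ Real.exp (p.h * p.τ) := by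
  have h := (mem_returns_iff hB).1 hY
  have i1 := h.2.2.1.const_mul (p.α * Real.exp (p.h * p.τ))
  have i2 := (integrable_mertonDual (p := p) hB).const_mul (1 - p.α)
  have := integral_mono (integrable_rpow_of_mem_returns hB hp hY) (i1.add i2)
    fun ω => rpow_le_mertonDual hp (h.2.1 ω) ω
  simp only [Pi.add_apply] at this
  rw [integral_add i1 i2, integral_const_mul, integral_const_mul, integral_mertonDual hB hp] at this
  have hc : 0 ≤ p.α * Real.exp (p.h * p.τ) := (mul_pos hp.α_pos (Real.exp_pos _)).le
  have := mul_le_mul_of_nonneg_left h.2.2.2 hc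
  linarith

lemma integral_rpow_nonneg {Y : Ω → ℝ} (hY : Y ∈ returns p P B) : 0 ≤ ∫ ω, Y ω ^ p.α ∂P :=
  integral_nonneg fun ω => Real.rpow_nonneg (hY.2.1 ω) _

lemma measurable_U : Measurable p.U := by
  unfold Params.U
  exact Measurable.ite measurableSet_Ici (by fun_prop) (by fun_prop)

lemma measurable_F (θ : ℝ) : Measurable fun y => p.F y θ := by
  unfold Params.F
  exact (measurable_U.comp (measurable_id.sub_const _)).add
    ((measurable_id.pow_const _).const_mul _)

lemma abs_U_le (hp : p.Standing) {y : ℝ} (hy : 0 ≤ y) :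
    |p.U (y - p.γ)| ≤ (1 + p.k) * (y ^ p.α + p.γ ^ p.α) := by
  have h1 : |y - p.γ| ^ p.α ≤ y ^ p.α + p.γ ^ p.α := by
    refine (Real.rpow_le_rpow (abs_nonneg _) ?_ hp.α_pos.le).trans
      (Real.rpow_add_le_add_rpow hy hp.γ_pos.le hp.α_pos.le hp.α_lt_one.le)
    rw [abs_le]
    constructor <;> linarith [hp.γ_pos]
  have h2 : 0 ≤ |y - p.γ| ^ p.α := Real.rpow_nonneg (abs_nonneg _) _
  have hk := hp.k_nonneg
  unfold Params.U
  split_ifs with h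
  · rw [abs_of_nonneg h] at h1 h2
    rw [abs_of_nonneg h2]
    nlinarith
  · rw [neg_mul, abs_neg, abs_mul, abs_of_nonneg hk, abs_of_nonneg h2]
    nlinarith

lemma Phi_le {θ c : ℝ} (h : ∀ Y ∈ returns p P B, objective p P θ Y ≤ c) : Phi p P B θ ≤ c := by
  refine csSup_le ⟨_, _, zero_mem_returns, rfl⟩ ?_
  rintro _ ⟨Y, hY, rfl⟩
  exact h Y hY

variable [IsProbabilityMeasure P]

lemma integrable_U [P.IsComplete] (hB : IsBrownianReal B P) (hp : p.Standing)
    {Y : Ω → ℝ} (hY : Y ∈ returns p P B) : Integrable (fun ω => p.U (Y ω - p.γ)) P :=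
  Integrable.mono' (((integrable_rpow_of_mem_returns hB hp hY).add
    (integrable_const (p.γ ^ p.α))).const_mul (1 + p.k))
    (measurable_U.comp ((measurable_of_mem_returns hB hY).sub_const _)).aestronglyMeasurable
    (ae_of_all _ fun ω => abs_U_le hp (hY.2.1 ω))

lemma integrable_F [P.IsComplete] (hB : IsBrownianReal B P) (hp : p.Standing)
    {Y : Ω → ℝ} (hY : Y ∈ returns p P B) (θ : ℝ) : Integrable (fun ω => p.F (Y ω) θ) P :=
  (integrable_U hB hp hY).add ((integrable_rpow_of_mem_returns hB hp hY).const_mul θ)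

lemma objective_eq [P.IsComplete] (hB : IsBrownianReal B P) (hp : p.Standing)
    {Y : Ω → ℝ} (hY : Y ∈ returns p P B) (θ : ℝ) :
    objective p P θ Y = ∫ ω, p.U (Y ω - p.γ) ∂P + θ * ∫ ω, Y ω ^ p.α ∂P := by
  unfold objective Params.F
  rw [integral_add (integrable_U hB hp hY)
    ((integrable_rpow_of_mem_returns hB hp hY).const_mul θ), integral_const_mul]

lemma bddAbove_objective [P.IsComplete] (hB : IsBrownianReal B P) (hp : p.Standing) (θ : ℝ) :
    BddAbove (objective p P θ '' returns p P B) := by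
  refine ⟨(1 + p.k) * (Real.exp (p.h * p.τ) + p.γ ^ p.α) + |θ| * Real.exp (p.h * p.τ), ?_⟩
  rintro _ ⟨Y, hY, rfl⟩
  have hi := integrable_rpow_of_mem_returns hB hp hY
  have hM := integral_rpow_le hB hp hY
  have h0 := integral_rpow_nonneg hY
  have h1 : ∫ ω, p.U (Y ω - p.γ) ∂P ≤ (1 + p.k) * (∫ ω, Y ω ^ p.α ∂P + p.γ ^ p.α) := by
    have := integral_mono (integrable_U hB hp hY)
      ((hi.add (integrable_const (p.γ ^ p.α))).const_mul (1 + p.k))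
      fun ω => (le_abs_self _).trans (abs_U_le hp (hY.2.1 ω))
    rw [integral_const_mul] at this
    simp only [Pi.add_apply] at this
    rw [integral_add hi (integrable_const _)] at this
    simpa using this
  rw [objective_eq hB hp hY]
  have h2 : θ * ∫ ω, Y ω ^ p.α ∂P ≤ |θ| * Real.exp (p.h * p.τ) :=
    mul_le_mul (le_abs_self θ) hM h0 (abs_nonneg θ)
  have h3 := mul_le_mul_of_nonneg_left (add_le_add_left hM (p.γ ^ p.α))
    (by linarith [hp.k_nonneg] : 0 ≤ 1 + p.k)
  linarith

lemma objective_le_Phi [P.IsComplete] (hB : IsBrownianReal B P) (hp : p.Standing)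
    {Y : Ω → ℝ} (hY : Y ∈ returns p P B) (θ : ℝ) : objective p P θ Y ≤ Phi p P B θ :=
  le_csSup (bddAbove_objective hB hp θ) ⟨Y, hY, rfl⟩

lemma mem_argmaxSet_iff [P.IsComplete] (hB : IsBrownianReal B P) (hp : p.Standing)
    {Y : Ω → ℝ} {θ : ℝ} :
    Y ∈ argmaxSet p P B θ ↔ Y ∈ returns p P B ∧ objective p P θ Y = Phi p P B θ := by
  refine and_congr_right fun hY => ⟨fun h => ?_, fun h Y' hY' => ?_⟩
  · exact (objective_le_Phi hB hp hY θ).antisymm (Phi_le fun Y' hY' => h hY')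
  · exact (objective_le_Phi hB hp hY' θ).trans h.ge

/-- The objective is affine in `θ` with slope `E[Y^α]`, so the Merton bound is a Lipschitz constant
for the supremum. -/
lemma Phi_sub_le [P.IsComplete] (hB : IsBrownianReal B P) (hp : p.Standing) {x y : ℝ}
    (hxy : x ≤ y) : Phi p P B y - Phi p P B x ≤ Real.exp (p.h * p.τ) * (y - x) := by
  rw [sub_le_iff_le_add]
  refine Phi_le fun Y hY => ?_
  have h := objective_le_Phi hB hp hY x
  rw [objective_eq hB hp hY] at h ⊢
  have := mul_le_mul_of_nonneg_right (integral_rpow_le hB hp hY) (sub_nonneg.2 hxy)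
  linarith

lemma Phi_mono [P.IsComplete] (hB : IsBrownianReal B P) (hp : p.Standing) {x y : ℝ}
    (hxy : x ≤ y) : Phi p P B x ≤ Phi p P B y := by
  refine Phi_le fun Y hY => (le_trans ?_ (objective_le_Phi hB hp hY y))
  rw [objective_eq hB hp hY, objective_eq hB hp hY]
  have := mul_le_mul_of_nonneg_right hxy (integral_rpow_nonneg hY)
  linarith

lemma exp_discount_lt_one (hp : p.Standing) :
    Real.exp (-p.δ * p.τ) * Real.exp (p.h * p.τ) < 1 := by
  rw [← Real.exp_add, Real.exp_lt_one_iff]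
  have : (0 : ℝ) < p.τ := hp.τ_pos
  nlinarith [hp.h_lt_δ]

/-- The discounted value function is a strict contraction. -/
lemma discounted_Phi_sub_lt [P.IsComplete] (hB : IsBrownianReal B P) (hp : p.Standing) {x y : ℝ}
    (hxy : x < y) :
    Real.exp (-p.δ * p.τ) * Phi p P B y - Real.exp (-p.δ * p.τ) * Phi p P B x < y - x := by
  have h1 := mul_le_mul_of_nonneg_left (Phi_sub_le hB hp hxy.le) (Real.exp_pos (-p.δ * p.τ)).le
  have h2 := mul_lt_mul_of_pos_right (exp_discount_lt_one hp) (sub_pos.2 hxy)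
  linarith

/-- The contraction principle supplies a fixed point, so the choice made by `Classical.epsilon` is a
genuine one. -/
lemma thetaStar_eq [P.IsComplete] (hB : IsBrownianReal B P) (hp : p.Standing) {κ : ℝ}
    (h0 : 0 ≤ κ) (h1 : κ ≤ 1) :
    Real.exp (-p.δ * p.τ) * Phi p P B (κ * thetaStar p P B κ) = thetaStar p P B κ := by
  have hlip : ∀ x y : ℝ, x ≤ y →
      dist (Real.exp (-p.δ * p.τ) * Phi p P B (κ * x)) (Real.exp (-p.δ * p.τ) * Phi p P B (κ * y))
        ≤ Real.exp (-p.δ * p.τ) * Real.exp (p.h * p.τ) * dist x y := by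
    intro x y hxy
    have hk := mul_le_mul_of_nonneg_left hxy h0
    have a1 := Phi_mono hB hp hk
    have a2 := Phi_sub_le hB hp hk
    have a3 : Real.exp (p.h * p.τ) * (κ * y - κ * x) ≤ Real.exp (p.h * p.τ) * (y - x) := by
      refine mul_le_mul_of_nonneg_left ?_ (Real.exp_pos _).le
      nlinarith
    rw [Real.dist_eq, ← mul_sub, abs_mul, abs_of_pos (Real.exp_pos _), Real.dist_eq,
      abs_sub_comm, abs_of_nonneg (sub_nonneg.2 a1), abs_sub_comm x y,
      abs_of_nonneg (sub_nonneg.2 hxy), mul_assoc]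
    exact mul_le_mul_of_nonneg_left (a2.trans a3) (Real.exp_pos _).le
  have hc : ContractingWith (Real.exp (-p.δ * p.τ) * Real.exp (p.h * p.τ)).toNNReal
      (fun x : ℝ => Real.exp (-p.δ * p.τ) * Phi p P B (κ * x)) := by
    refine ⟨by simpa using exp_discount_lt_one hp, LipschitzWith.of_dist_le_mul fun x y => ?_⟩
    rw [Real.coe_toNNReal _ (by positivity)]
    rcases le_total x y with h | h
    · exact hlip x y h
    · rw [dist_comm, dist_comm x y]
      exact hlip y x h
  exact Classical.epsilon_spec (p := fun θ : ℝ =>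
    Function.IsFixedPt (fun x : ℝ => Real.exp (-p.δ * p.τ) * Phi p P B (κ * x)) θ)
    ⟨_, hc.fixedPoint_isFixedPt⟩

end Market

/-! ### The effective utility on both sides of the benchmark. -/

section Utility

variable {p : Params}

lemma F_of_le {y θ : ℝ} (h : p.γ ≤ y) : p.F y θ = (y - p.γ) ^ p.α + θ * y ^ p.α := by
  rw [Params.F, Params.U, if_pos (sub_nonneg.2 h)]

lemma F_of_lt {y θ : ℝ} (h : y < p.γ) :
    p.F y θ = -p.k * (p.γ - y) ^ p.α + θ * y ^ p.α := by
  rw [Params.F, Params.U, if_neg (by linarith), abs_of_neg (by linarith), neg_sub]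

lemma F_le_max_mul (hp : p.Standing) {y θ : ℝ} (h0 : 0 ≤ y) (h : y ≤ p.γ) :
    p.F y θ ≤ max θ 0 * p.γ ^ p.α := by
  have e : p.F y θ ≤ θ * y ^ p.α := by
    rcases h.eq_or_lt with rfl | h
    · rw [F_of_le le_rfl, sub_self, Real.zero_rpow hp.α_pos.ne', zero_add]
    · rw [F_of_lt h]
      have := mul_nonneg hp.k_nonneg (Real.rpow_nonneg (sub_nonneg.2 h.le) p.α)
      linarith
  exact e.trans (mul_le_mul (le_max_left _ _) (Real.rpow_le_rpow h0 h hp.α_pos.le)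
    (Real.rpow_nonneg h0 _) (le_max_right _ _))

/-- For negative `θ` the effective utility on `[0, γ]` is dominated by its larger endpoint
value. -/
lemma F_le_of_nonpos (hp : p.Standing) {y θ : ℝ} (hθ : θ ≤ 0) (h0 : 0 ≤ y) (h : y ≤ p.γ) :
    p.F y θ ≤ -(min p.k (-θ)) * p.γ ^ p.α := by
  have hγ := hp.γ_pos
  set u := y / p.γ with hu
  have hyu : y = p.γ * u := by rw [hu]; field_simp
  have hu0 : 0 ≤ u := div_nonneg h0 hγ.le
  have hu1 : u ≤ 1 := (div_le_one hγ).2 h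
  -- This bounds `k(1-u)^α + (-θ)u^α` below by the convex combination `k(1-u) + (-θ)u`.
  have hpow : ∀ v : ℝ, 0 ≤ v → v ≤ 1 → v ≤ v ^ p.α := fun v hv hv1 =>
    Real.self_le_rpow_of_le_one hv hv1 hp.α_lt_one.le
  have e : p.F y θ = (-p.k * (1 - u) ^ p.α + θ * u ^ p.α) * p.γ ^ p.α := by
    have e1 : y ^ p.α = p.γ ^ p.α * u ^ p.α := by rw [hyu, Real.mul_rpow hγ.le hu0]
    have e2 : (p.γ - y) ^ p.α = p.γ ^ p.α * (1 - u) ^ p.α := by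
      rw [← Real.mul_rpow hγ.le (sub_nonneg.2 hu1), hyu]
      ring_nf
    rcases h.eq_or_lt with h' | h'
    · have hu' : u = 1 := by rw [hu, h', div_self hγ.ne']
      rw [F_of_le h'.ge, h', sub_self, hu', sub_self, Real.zero_rpow hp.α_pos.ne', Real.one_rpow]
      ring
    · rw [F_of_lt h', e1, e2]
      ring
  rw [e]
  refine mul_le_mul_of_nonneg_right ?_ (Real.rpow_nonneg hγ.le _)
  have a1 := hpow u hu0 hu1
  have a2 := hpow (1 - u) (sub_nonneg.2 hu1) (by linarith)
  have b1 := mul_le_mul_of_nonneg_left a1 (neg_nonneg.2 hθ)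
  have b2 := mul_le_mul_of_nonneg_left a2 hp.k_nonneg
  have b3 := mul_le_mul_of_nonneg_right (min_le_left p.k (-θ)) (sub_nonneg.2 hu1)
  have b4 := mul_le_mul_of_nonneg_right (min_le_right p.k (-θ)) hu0
  linarith

/-- The point `γm/(m-1)` is the critical point of `F` beyond `γ` for the weight `-m^(1-α)`. For `m =
1 + k^(1/(1-α))` the value equals `F(0; θ) = -kγ^α`, which explains the threshold. -/
lemma F_of_ratio (hp : p.Standing) {m : ℝ} (hm : 1 < m) :
    p.F (p.γ * (m / (m - 1))) (-m ^ (1 - p.α)) = -(m - 1) ^ (1 - p.α) * p.γ ^ p.α := by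
  have hγ := hp.γ_pos
  have hm1 : 0 < m - 1 := sub_pos.2 hm
  have hm0 : 0 < m := by linarith
  have hle : p.γ ≤ p.γ * (m / (m - 1)) :=
    le_mul_of_one_le_right hγ.le ((one_le_div hm1).2 (by linarith))
  have e : p.γ * (m / (m - 1)) - p.γ = p.γ * (1 / (m - 1)) := by
    field_simp
    ring
  rw [F_of_le hle, e, Real.mul_rpow hγ.le (by positivity), Real.mul_rpow hγ.le (by positivity),
    Real.div_rpow hm0.le hm1.le, Real.div_rpow zero_le_one hm1.le, Real.one_rpow,
    Real.rpow_sub hm0, Real.rpow_sub hm1, Real.rpow_one, Real.rpow_one]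
  have h1 := (Real.rpow_pos_of_pos hm0 p.α).ne'
  have h2 := (Real.rpow_pos_of_pos hm1 p.α).ne'
  field_simp
  ring

/-- Above the threshold some return beyond the benchmark beats, by a fixed margin, every return
that does not exceed the benchmark. -/
lemma exists_gt_F_add_le (hp : p.Standing) {θ : ℝ} (hθ : p.thetaLow < θ) :
    ∃ y₀ g : ℝ, p.γ < y₀ ∧ 0 < g ∧ ∀ y, 0 ≤ y → y ≤ p.γ → p.F y θ + g ≤ p.F y₀ θ := by
  have hγ := hp.γ_pos
  have hγα : 0 < p.γ ^ p.α := Real.rpow_pos_of_pos hγ _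
  have hα1 : 0 < 1 - p.α := sub_pos.2 hp.α_lt_one
  rcases lt_or_ge (-1) θ with h | h
  -- By subadditivity of the power, `F(y; θ) ≥ (1+θ)y^α - γ^α` beyond `γ`, which is unbounded for `θ
  -- > -1`.
  · have ht : Filter.Tendsto (fun y : ℝ => (1 + θ) * y ^ p.α) Filter.atTop Filter.atTop :=
      (tendsto_rpow_atTop hp.α_pos).const_mul_atTop (by linarith)
    obtain ⟨y₀, hy₀, hy₁⟩ := ((ht.eventually_ge_atTop
      (p.γ ^ p.α + max θ 0 * p.γ ^ p.α + 1)).and (Filter.eventually_gt_atTop p.γ)).exists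
    refine ⟨y₀, 1, hy₁, one_pos, fun y h0 h1 => ?_⟩
    have a := F_le_max_mul (θ := θ) hp h0 h1
    have b := Real.rpow_add_le_add_rpow (sub_nonneg.2 hy₁.le) hγ.le hp.α_pos.le hp.α_lt_one.le
    rw [sub_add_cancel] at b
    rw [F_of_le hy₁.le]
    linarith
  · have hθ1 : 1 ≤ -θ := by linarith
    set s := (-θ) ^ (1 / (1 - p.α)) with hs
    have hs1 : 1 ≤ s := Real.one_le_rpow hθ1 (by positivity)
    have hsθ : s ^ (1 - p.α) = -θ := by
      rw [hs, ← Real.rpow_mul (by linarith), one_div_mul_cancel hα1.ne', Real.rpow_one]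
    set q := p.k ^ (1 / (1 - p.α)) with hq
    have hq0 : 0 ≤ q := Real.rpow_nonneg hp.k_nonneg _
    have hqk : q ^ (1 - p.α) = p.k := by
      rw [hq, ← Real.rpow_mul hp.k_nonneg, one_div_mul_cancel hα1.ne', Real.rpow_one]
    have hsq : s < 1 + q := by
      by_contra hc
      have := Real.rpow_le_rpow (by linarith) (not_lt.1 hc) hα1.le
      rw [hsθ] at this
      have hθ' : -(1 + q) ^ (1 - p.α) < θ := hθ
      linarith
    -- `m > s` gives `-m^(1-α) ≤ θ` and `m > 1`; the two upper bounds give `(m-1)^(1-α) < min k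
    -- (-θ)`, the required margin.
    obtain ⟨m, hm1, hm2⟩ := exists_between (lt_min hsq (lt_one_add s))
    have hmq : m < 1 + q := hm2.trans_le (min_le_left _ _)
    have hms : m < 1 + s := hm2.trans_le (min_le_right _ _)
    have hm : 1 < m := by linarith
    have hθm : -m ^ (1 - p.α) ≤ θ := by
      have := Real.rpow_le_rpow (by linarith) hm1.le hα1.le
      rw [hsθ] at this
      linarith
    have hlt : (m - 1) ^ (1 - p.α) < min p.k (-θ) := by
      rw [← hsθ, ← hqk]
      exact lt_min (Real.rpow_lt_rpow (by linarith) (by linarith) hα1)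
        (Real.rpow_lt_rpow (by linarith) (by linarith) hα1)
    have hpos : 0 < m - 1 := by linarith
    refine ⟨p.γ * (m / (m - 1)), (min p.k (-θ) - (m - 1) ^ (1 - p.α)) * p.γ ^ p.α,
      lt_mul_of_one_lt_right hγ ((one_lt_div hpos).2 (by linarith)),
      mul_pos (sub_pos.2 hlt) hγα, fun y h0 h1 => ?_⟩
    have a := F_le_of_nonpos hp (by linarith : θ ≤ 0) h0 h1
    have b := F_of_ratio hp hm
    have c : p.F (p.γ * (m / (m - 1))) (-m ^ (1 - p.α)) ≤ p.F (p.γ * (m / (m - 1))) θ := by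
      unfold Params.F
      have := mul_le_mul_of_nonneg_right hθm
        (Real.rpow_nonneg (by positivity : 0 ≤ p.γ * (m / (m - 1))) p.α)
      linarith
    linarith

lemma abs_F_le (hp : p.Standing) {y θ : ℝ} (h0 : 0 ≤ y) (h : y ≤ p.γ) :
    |p.F y θ| ≤ (1 + p.k) * (p.γ ^ p.α + p.γ ^ p.α) + |θ| * p.γ ^ p.α := by
  have h1 := Real.rpow_le_rpow h0 h hp.α_pos.le
  refine (abs_add_le _ _).trans (add_le_add ((abs_U_le hp h0).trans ?_) ?_)
  · exact mul_le_mul_of_nonneg_left (by linarith) (by linarith [hp.k_nonneg])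
  · rw [abs_mul, abs_of_nonneg (Real.rpow_nonneg h0 _)]
    exact mul_le_mul_of_nonneg_left h1 (abs_nonneg _)

end Utility

/-! ### Optimal returns above the threshold exceed the benchmark. -/

/-- A set carried by a bounded range of a random variable without atoms contains slices of every
smaller probability. -/
lemma exists_measureReal_inter_Iic_eq {Ω : Type*} [MeasurableSpace Ω] {P : Measure Ω}
    [IsFiniteMeasure P] {X : Ω → ℝ} (hX : Measurable X) (hatom : ∀ x, P {ω | X ω = x} = 0)
    {C : Set Ω} {a b : ℝ} (hab : a ≤ b) (hCab : ∀ ω ∈ C, X ω ∈ Set.Ioc a b)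
    {c : ℝ} (hc0 : 0 ≤ c) (hc : c ≤ P.real C) :
    ∃ t, P.real (C ∩ {ω | X ω ≤ t}) = c := by
  set ν := (P.restrict C).map X with hν
  have : NullSingletonClass ν := by
    refine ⟨fun x => ?_⟩
    rw [hν, Measure.map_apply hX (measurableSet_singleton x)]
    exact le_antisymm ((Measure.restrict_apply_le _ _).trans (hatom x).le) bot_le
  have hf : ∀ t, a ≤ t → ∫ _ in a..t, (1 : ℝ) ∂ν = P.real (C ∩ {ω | X ω ≤ t}) := by
    intro t ht
    have hms : MeasurableSet (X ⁻¹' Set.Ioc a t) := hX measurableSet_Ioc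
    rw [intervalIntegral.integral_of_le ht, integral_const, smul_eq_mul, mul_one,
      measureReal_restrict_apply_univ, hν, map_measureReal_apply hX measurableSet_Ioc,
      measureReal_restrict_apply hms]
    congr 1
    ext ω
    constructor
    · rintro ⟨h1, h2⟩
      exact ⟨h2, h1.2⟩
    · rintro ⟨h1, h2⟩
      exact ⟨⟨(hCab ω h1).1, h2⟩, h1⟩
  -- The primitive of `1` is the distribution function of `X` on `C`; absence of atoms makes it
  -- continuous.
  have hcont : Continuous fun t => ∫ _ in a..t, (1 : ℝ) ∂ν :=
    intervalIntegral.continuous_primitive (fun _ _ => intervalIntegrable_const) a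
  have hb : ∫ _ in a..b, (1 : ℝ) ∂ν = P.real C := by
    rw [hf b hab]
    congr 1
    exact Set.inter_eq_left.2 fun ω hω => (hCab ω hω).2
  have hmem : c ∈ Set.Icc (∫ _ in a..a, (1 : ℝ) ∂ν) (∫ _ in a..b, (1 : ℝ) ∂ν) := by
    rw [hb, intervalIntegral.integral_same]
    exact ⟨hc0, hc⟩
  obtain ⟨t, ht, htc⟩ := intermediate_value_Icc hab hcont.continuousOn hmem
  exact ⟨t, (hf t ht.1).symm.trans htc⟩

section Market

variable {Ω : Type*} [MeasurableSpace Ω] {P : Measure Ω} {B : ℝ≥0 → Ω → ℝ} {p : Params}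

lemma measure_brownian_eq [P.IsComplete] (hB : IsBrownianReal B P) {t : ℝ≥0} (ht : t ≠ 0)
    (x : ℝ) : P {ω | B t ω = x} = 0 := by
  have hl := hB.toIsPreBrownianReal.hasLaw_eval t
  have := nullSingletonClass_gaussianReal (μ := 0) ht
  have h := measure_singleton (μ := gaussianReal 0 t) x
  rwa [← hl.map_eq, Measure.map_apply (measurable_brownian hB t) (measurableSet_singleton x)] at h

lemma measure_kernelZ_eq [P.IsComplete] (hB : IsBrownianReal B P) (hp : p.Standing) (z : ℝ) :
    P {ω | kernelZ p B p.τ ω = z} = 0 := by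
  refine measure_mono_null (fun ω hω => ?_) (measure_brownian_eq hB hp.τ_pos.ne'
    ((Real.log z + (p.r + p.φ ^ 2 / 2) * p.τ) / (-p.φ)))
  have h : Real.exp (-p.φ * B p.τ ω - (p.r + p.φ ^ 2 / 2) * p.τ) = z := hω
  have h' : B p.τ ω = (Real.log z + (p.r + p.φ ^ 2 / 2) * p.τ) / (-p.φ) := by
    rw [← h, Real.log_exp, eq_div_iff (neg_ne_zero.2 hp.φ_ne_zero)]
    ring
  exact h'

/-- Arbitrarily cheap states exist: since `φ ≠ 0`, they form a nonempty open condition on the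
Gaussian `B_τ`. -/
lemma measure_kernelZ_lt_pos [P.IsComplete] (hB : IsBrownianReal B P) (hp : p.Standing) {ε : ℝ}
    (hε : 0 < ε) : 0 < P {ω | kernelZ p B p.τ ω < ε} := by
  have hl := hB.toIsPreBrownianReal.hasLaw_eval p.τ
  set f : ℝ → ℝ := fun x => Real.exp (-p.φ * x - (p.r + p.φ ^ 2 / 2) * p.τ) with hf
  have hfc : Continuous f := by fun_prop
  have ho : IsOpen (f ⁻¹' Set.Iio ε) := isOpen_Iio.preimage hfc
  have hne : (f ⁻¹' Set.Iio ε).Nonempty := by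
    refine ⟨(Real.log ε - 1 + (p.r + p.φ ^ 2 / 2) * p.τ) / (-p.φ), ?_⟩
    have hφ := neg_ne_zero.2 hp.φ_ne_zero
    rw [Set.mem_preimage, hf, Set.mem_Iio]
    simp only
    rw [mul_div_cancel₀ _ hφ, add_sub_cancel_right, ← Real.lt_log_iff_exp_lt hε]
    linarith
  have hpos : 0 < gaussianReal 0 p.τ (f ⁻¹' Set.Iio ε) := by
    refine pos_iff_ne_zero.2 fun h0 => (ho.measure_pos volume hne).ne' ?_
    exact gaussianReal_absolutelyContinuous' 0 hp.τ_pos.ne' h0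
  rwa [← hl.map_eq, Measure.map_apply (measurable_brownian hB _) ho.measurableSet] at hpos

variable [IsProbabilityMeasure P]

/-- Redistributing wealth from a set `C` to a set `A` of cheap states: if this is affordable, it
cannot improve on an optimal return. -/
lemma gain_le_of_mem_argmaxSet [P.IsComplete] (hB : IsBrownianReal B P) (hp : p.Standing)
    {θ : ℝ} {Y : Ω → ℝ} (hY : Y ∈ argmaxSet p P B θ) (hYγ : ∀ᵐ ω ∂P, Y ω ≤ p.γ)
    {y₀ g K ε : ℝ} (hy₀ : 0 ≤ y₀) (hε : 0 < ε)
    (hgain : ∀ y, 0 ≤ y → y ≤ p.γ → p.F y θ + g ≤ p.F y₀ θ)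
    (hK : ∀ y, 0 ≤ y → y ≤ p.γ → p.F y θ - p.F 0 θ ≤ K) (hK0 : 0 ≤ K)
    {C : Set Ω} (hC : MeasurableSet[augmentedSigma P B p.τ] C)
    (hbudget : ∫ ω, kernelZ p B p.τ ω * Y ω ∂P
        + y₀ * (ε * P.real {ω | kernelZ p B p.τ ω < ε})
      ≤ 1 + ∫ ω in C, kernelZ p B p.τ ω * Y ω ∂P) :
    g * P.real {ω | kernelZ p B p.τ ω < ε} ≤ K * P.real C := by
  classical
  have hle := augmentedSigma_le hB p.τ
  obtain ⟨hYm, hY0, hYi, -⟩ := (mem_returns_iff hB).1 hY.1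
  set Z := kernelZ p B p.τ with hZ
  have hZ0 : ∀ ω, 0 < Z ω := kernelZ_pos p.τ
  set A : Set Ω := {ω | Z ω < ε} with hA
  have hAm : MeasurableSet[augmentedSigma P B p.τ] A :=
    (kernelZ_measurable_augmentedSigma p.τ) measurableSet_Iio
  set Y' : Ω → ℝ := A.piecewise (fun _ => y₀) (C.piecewise (fun _ => 0) Y) with hY'
  have hY'm : Measurable[augmentedSigma P B p.τ] Y' :=
    Measurable.piecewise hAm (@measurable_const _ _ _ (_) _)
      (Measurable.piecewise hC (@measurable_const _ _ _ (_) _) hYm)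
  have hY'0 : ∀ ω, 0 ≤ Y' ω := by
    intro ω
    simp only [hY', Set.piecewise]
    split_ifs
    exacts [hy₀, le_rfl, hY0 ω]
  have hAi : Integrable (A.indicator Z) P := by
    refine Integrable.mono' (integrable_const ε)
      ((measurable_kernelZ hB p.τ).indicator (hle _ hAm)).aestronglyMeasurable
      (ae_of_all _ fun ω => ?_)
    by_cases h : ω ∈ A
    · rw [Set.indicator_of_mem h, Real.norm_of_nonneg (hZ0 ω).le]
      exact le_of_lt h
    · rw [Set.indicator_of_notMem h, norm_zero]
      exact hε.le
  have hCi : Integrable (C.indicator fun ω => Z ω * Y ω) P := hYi.indicator (hle _ hC)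
  have hbi := (hYi.sub hCi).add (hAi.const_mul y₀)
  have hbound : ∀ ω, Z ω * Y' ω ≤
      Z ω * Y ω - C.indicator (fun ω => Z ω * Y ω) ω + y₀ * A.indicator Z ω := by
    intro ω
    have h1 := mul_nonneg (hZ0 ω).le (hY0 ω)
    have h2 := mul_nonneg hy₀ (hZ0 ω).le
    by_cases hωA : ω ∈ A <;> by_cases hωC : ω ∈ C <;>
      simp [hY', hωA, hωC] <;> linarith
  have hY'i : Integrable (fun ω => Z ω * Y' ω) P := by
    refine Integrable.mono' hbi ((measurable_kernelZ hB p.τ).mul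
      (hY'm.mono hle le_rfl)).aestronglyMeasurable (ae_of_all _ fun ω => ?_)
    rw [Real.norm_of_nonneg (mul_nonneg (hZ0 ω).le (hY'0 ω))]
    exact hbound ω
  have hAε : ∫ ω, A.indicator Z ω ∂P ≤ ε * P.real A := by
    have h := integral_mono hAi ((integrable_const ε).indicator (hle _ hAm)) fun ω => by
      by_cases hω : ω ∈ A
      · simpa [hω] using le_of_lt (show Z ω < ε from hω)
      · simp [hω]
    rw [integral_indicator_const ε (hle _ hAm), smul_eq_mul, mul_comm] at h
    exact h
  have hY'mem : Y' ∈ returns p P B := by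
    refine (mem_returns_iff hB).2 ⟨hY'm, hY'0, hY'i, ?_⟩
    have h := integral_mono hY'i hbi hbound
    rw [integral_add' (hYi.sub hCi) (hAi.const_mul y₀), integral_sub' hYi hCi, integral_const_mul,
      integral_indicator (hle _ hC)] at h
    have := mul_le_mul_of_nonneg_left hAε hy₀
    linarith
  have hopt : objective p P θ Y' ≤ objective p P θ Y := hY.2 hY'mem
  have gi : Integrable (A.indicator fun _ => g) P := (integrable_const g).indicator (hle _ hAm)
  have Ki : Integrable (C.indicator fun _ => K) P := (integrable_const K).indicator (hle _ hC)
  have Fi := integrable_F hB hp hY.1 θ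
  -- Pointwise, the change gains at least `g` on `A` and loses at most `K` on `C`; `K ≥ 0` covers
  -- the overlap.
  have h := integral_mono_ae ((Fi.add gi).sub Ki) (integrable_F hB hp hY'mem θ) (by
    filter_upwards [hYγ] with ω hω
    have h1 := hgain _ (hY0 ω) hω
    have h2 := hK _ (hY0 ω) hω
    by_cases hωA : ω ∈ A <;> by_cases hωC : ω ∈ C <;>
      simp [hY', hωA, hωC] <;> linarith)
  rw [integral_sub' (Fi.add gi) Ki, integral_add' Fi gi, integral_indicator_const g (hle _ hAm),
    integral_indicator_const K (hle _ hC), smul_eq_mul, smul_eq_mul] at h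
  unfold objective at hopt
  linarith

/-- Above the threshold, an optimal return exceeds the benchmark with positive probability. -/
lemma measure_gt_pos_of_mem_argmaxSet [P.IsComplete] (hB : IsBrownianReal B P) (hp : p.Standing)
    {θ : ℝ} (hθ : p.thetaLow < θ) {Y : Ω → ℝ} (hY : Y ∈ argmaxSet p P B θ) :
    0 < P {ω | p.γ < Y ω} := by
  refine pos_iff_ne_zero.2 fun hnull => ?_
  have hYγ : ∀ᵐ ω ∂P, Y ω ≤ p.γ := by
    rw [ae_iff]
    simpa using hnull
  obtain ⟨hYm, hY0, hYi, hY1⟩ := (mem_returns_iff hB).1 hY.1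
  obtain ⟨y₀, g, hy₀, hg, hgain⟩ := exists_gt_F_add_le hp hθ
  have hy₀' : 0 < y₀ := hp.γ_pos.trans hy₀
  obtain ⟨K, hK0, hK⟩ : ∃ K : ℝ, 0 < K ∧ ∀ y, 0 ≤ y → y ≤ p.γ → p.F y θ - p.F 0 θ ≤ K := by
    set K₀ := (1 + p.k) * (p.γ ^ p.α + p.γ ^ p.α) + |θ| * p.γ ^ p.α
    have h0 : 0 ≤ K₀ := (abs_nonneg _).trans (abs_F_le (θ := θ) hp le_rfl hp.γ_pos.le)
    refine ⟨2 * K₀ + 1, by linarith, fun y h1 h2 => ?_⟩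
    have a := le_of_abs_le (abs_F_le (θ := θ) hp h1 h2)
    have b := neg_le_of_abs_le (abs_F_le (θ := θ) hp le_rfl hp.γ_pos.le)
    linarith
  have hApos : ∀ ε : ℝ, 0 < ε → 0 < P.real {ω | kernelZ p B p.τ ω < ε} := fun ε hε =>
    ENNReal.toReal_pos (measure_kernelZ_lt_pos hB hp hε).ne' (measure_ne_top _ _)
  have hA1 : ∀ ε : ℝ, P.real {ω | kernelZ p B p.τ ω < ε} ≤ 1 := fun ε => measureReal_le_one
  by_cases hzero : P {ω | 0 < Y ω} = 0
  -- If `Y = 0` almost surely the whole budget is free, and `ε = 1/y₀` needs no financing set.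
  · have hae : (fun ω => kernelZ p B p.τ ω * Y ω) =ᵐ[P] 0 := by
      have : ∀ᵐ ω ∂P, ¬ 0 < Y ω := by simpa only [ae_iff, not_not] using hzero
      filter_upwards [this] with ω hω
      simp [le_antisymm (not_lt.1 hω) (hY0 ω)]
    have hε : 0 < 1 / y₀ := by positivity
    have h := gain_le_of_mem_argmaxSet hB hp hY hYγ hy₀'.le hε hgain hK hK0.le
      (C := ∅) (@MeasurableSet.empty _ (_)) (by
        rw [integral_congr_ae hae]
        have := hA1 (1 / y₀)
        simp only [Pi.zero_apply, integral_zero, Measure.restrict_empty, integral_zero_measure]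
        rw [← mul_assoc, mul_one_div_cancel hy₀'.ne', one_mul]
        linarith)
    have := mul_pos hg (hApos _ hε)
    rw [measureReal_empty, mul_zero] at h
    linarith
  -- Giving up `Y` on part of `S n` frees at least `1/(n+1)` of budget per unit of probability; the
  -- bound on `B_τ` allows slicing.
  · set S : ℕ → Set Ω := fun n => {ω | 1 / ((n : ℝ) + 1) ≤ kernelZ p B p.τ ω * Y ω} ∩
      {ω | B p.τ ω ∈ Set.Ioc (-(n : ℝ)) n} with hS
    have hSm : ∀ n, MeasurableSet[augmentedSigma P B p.τ] (S n) := fun n =>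
      MeasurableSet.inter
        (((kernelZ_measurable_augmentedSigma p.τ).mul hYm) measurableSet_Ici)
        ((measurable_augmentedSigma p.τ) measurableSet_Ioc)
    obtain ⟨n, hn⟩ : ∃ n, P (S n) ≠ 0 := by
      by_contra! hc
      refine hzero (measure_mono_null (fun ω hω => ?_) (measure_iUnion_null hc))
      have hpos : 0 < kernelZ p B p.τ ω * Y ω := mul_pos (kernelZ_pos _ _) hω
      obtain ⟨n₁, hn₁⟩ := exists_nat_one_div_lt hpos
      obtain ⟨n₂, hn₂⟩ := exists_nat_gt |B p.τ ω|
      rw [abs_lt] at hn₂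
      have e1 : (n₁ : ℝ) ≤ (max n₁ n₂ : ℕ) := by exact_mod_cast le_max_left _ _
      have e2 : (n₂ : ℝ) ≤ (max n₁ n₂ : ℕ) := by exact_mod_cast le_max_right _ _
      refine Set.mem_iUnion.2 ⟨max n₁ n₂, ?_, ?_, ?_⟩
      · refine le_trans ?_ hn₁.le
        exact one_div_le_one_div_of_le (by positivity) (by linarith)
      · linarith
      · linarith
    have hSpos : 0 < P.real (S n) := ENNReal.toReal_pos hn (measure_ne_top _ _)
    have hn1 : (0 : ℝ) < n + 1 := by positivity
    -- A slice of probability `ε(n+1)y₀a`, with `a` the probability of `{Z < ε}`, finances the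
    -- purchase. The first bound fits it into `S n`; the second makes the loss smaller than the gain
    -- `g a`.
    obtain ⟨ε, hε, hεlt⟩ := exists_between
      (lt_min (div_pos hSpos (mul_pos hn1 hy₀')) (div_pos hg (mul_pos hK0 (mul_pos hn1 hy₀'))))
    have hε1 := (lt_div_iff₀ (mul_pos hn1 hy₀')).1 (hεlt.trans_le (min_le_left _ _))
    have hε2 := (lt_div_iff₀ (mul_pos hK0 (mul_pos hn1 hy₀'))).1
      (hεlt.trans_le (min_le_right _ _))
    set a := P.real {ω | kernelZ p B p.τ ω < ε} with ha
    have ha0 : 0 < a := hApos ε hε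
    have ha1 : a ≤ 1 := hA1 ε
    have hc0 : 0 ≤ ε * ((n + 1) * y₀) * a := by positivity
    have hcle : ε * ((n + 1) * y₀) * a ≤ P.real (S n) :=
      (mul_le_of_le_one_right (by positivity) ha1).trans hε1.le
    obtain ⟨t, ht⟩ := exists_measureReal_inter_Iic_eq (measurable_brownian hB p.τ)
      (measure_brownian_eq hB hp.τ_pos.ne') (C := S n) (a := -(n : ℝ)) (b := n)
      (by have : (0 : ℝ) ≤ n := n.cast_nonneg
          linarith) (fun ω hω => hω.2) hc0 hcle
    set C : Set Ω := S n ∩ {ω | B p.τ ω ≤ t} with hC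
    have hCm : MeasurableSet[augmentedSigma P B p.τ] C :=
      MeasurableSet.inter (hSm n) ((measurable_augmentedSigma p.τ) measurableSet_Iic)
    have hCm' : MeasurableSet C := augmentedSigma_le hB p.τ _ hCm
    have hCint : 1 / ((n : ℝ) + 1) * P.real C ≤ ∫ ω in C, kernelZ p B p.τ ω * Y ω ∂P := by
      have := setIntegral_mono_on (integrableOn_const (measure_ne_top P C))
        hYi.integrableOn hCm' (fun ω hω => hω.1.1)
      rwa [setIntegral_const, smul_eq_mul, mul_comm] at this
    have h := gain_le_of_mem_argmaxSet hB hp hY hYγ hy₀'.le hε hgain hK hK0.le hCm (by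
      rw [ht] at hCint
      have e : 1 / ((n : ℝ) + 1) * (ε * ((n + 1) * y₀) * a) = y₀ * (ε * a) := by
        field_simp
      linarith)
    rw [ht] at h
    have := mul_lt_mul_of_pos_right hε2 ha0
    linarith

end Market

/-! ### First-order conditions and uniqueness of the weight. -/

/-- A bounded function that is orthogonal to the orthogonal complement of `Z` in `L²(D)` is
proportional to `Z` on `D`. -/
lemma exists_ae_eq_const_mul_of_orthogonal {Ω : Type*} {m m0 : MeasurableSpace Ω} (hm : m ≤ m0)
    {P : Measure Ω} [IsFiniteMeasure P] {Z W : Ω → ℝ} (hZ : Measurable[m] Z)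
    (hW : Measurable[m] W) (hZ0 : ∀ ω, 0 < Z ω) {D : Set Ω} (hD : MeasurableSet[m] D)
    (hDpos : P D ≠ 0) {N : ℝ} (hZN : ∀ ω ∈ D, |Z ω| ≤ N) (hWN : ∀ ω ∈ D, |W ω| ≤ N)
    (h : ∀ η : Ω → ℝ, Measurable[m] η → (∃ K, ∀ ω, |η ω| ≤ K) → (∀ ω ∉ D, η ω = 0) →
      Integrable (fun ω => Z ω * η ω) P → ∫ ω, Z ω * η ω ∂P = 0 → ∫ ω, W ω * η ω ∂P = 0) :
    ∃ c : ℝ, ∀ᵐ ω ∂P, ω ∈ D → W ω = c * Z ω := by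
  have hbi : ∀ f g : Ω → ℝ, Measurable[m] f → Measurable[m] g → (∀ ω ∈ D, |f ω| ≤ N) →
      (∀ ω ∈ D, |g ω| ≤ N) → Integrable (D.indicator fun ω => f ω * g ω) P := by
    intro f g hf hg hfN hgN
    refine Integrable.mono' (integrable_const (N * N))
      (((hf.mul hg).indicator hD).mono hm le_rfl).aestronglyMeasurable (ae_of_all _ fun ω => ?_)
    by_cases hω : ω ∈ D
    · rw [Set.indicator_of_mem hω, norm_mul]
      exact mul_le_mul (hfN ω hω) (hgN ω hω) (abs_nonneg _) ((abs_nonneg _).trans (hfN ω hω))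
    · rw [Set.indicator_of_notMem hω, norm_zero]
      exact mul_self_nonneg N
  have iZZ := hbi Z Z hZ hZ hZN hZN
  have iZW := hbi Z W hZ hW hZN hWN
  have iWW := hbi W W hW hW hWN hWN
  have hpos : 0 < ∫ ω, D.indicator (fun ω => Z ω * Z ω) ω ∂P := by
    rw [integral_pos_iff_support_of_nonneg
      (Set.indicator_nonneg fun ω _ => mul_self_nonneg (Z ω)) iZZ]
    refine (pos_iff_ne_zero.2 hDpos).trans_le (measure_mono fun ω hω => ?_)
    rw [Function.mem_support, Set.indicator_of_mem hω]
    exact (mul_pos (hZ0 ω) (hZ0 ω)).ne'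
  -- The projection coefficient: the residual `η = W - cZ` on `D` is orthogonal to `Z`, hence by
  -- hypothesis to `W`, hence to itself.
  set c := (∫ ω, D.indicator (fun ω => Z ω * W ω) ω ∂P)
    / ∫ ω, D.indicator (fun ω => Z ω * Z ω) ω ∂P with hc
  set η : Ω → ℝ := D.indicator fun ω => W ω - c * Z ω with hη
  have hηm : Measurable[m] η := (hW.sub (hZ.const_mul c)).indicator hD
  have hηN : ∀ ω, |η ω| ≤ |N| + |c| * |N| := by
    intro ω
    by_cases hω : ω ∈ D
    · rw [hη, Set.indicator_of_mem hω]
      refine (abs_sub _ _).trans (add_le_add ((hWN ω hω).trans (le_abs_self N)) ?_)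
      rw [abs_mul]
      exact mul_le_mul_of_nonneg_left ((hZN ω hω).trans (le_abs_self N)) (abs_nonneg c)
    · rw [hη, Set.indicator_of_notMem hω, abs_zero]
      positivity
  have eZ : (fun ω => Z ω * η ω) = fun ω => D.indicator (fun ω => Z ω * W ω) ω
      - c * D.indicator (fun ω => Z ω * Z ω) ω := by
    ext ω
    by_cases hω : ω ∈ D
    · simp only [hη, Set.indicator_of_mem hω]
      ring
    · simp [hη, hω]
  have eW : (fun ω => W ω * η ω) = fun ω => D.indicator (fun ω => W ω * W ω) ω
      - c * D.indicator (fun ω => Z ω * W ω) ω := by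
    ext ω
    by_cases hω : ω ∈ D
    · simp only [hη, Set.indicator_of_mem hω]
      ring
    · simp [hη, hω]
  have iZη : Integrable (fun ω => Z ω * η ω) P := by
    rw [eZ]
    exact iZW.sub (iZZ.const_mul c)
  have iWη : Integrable (fun ω => W ω * η ω) P := by
    rw [eW]
    exact iWW.sub (iZW.const_mul c)
  have hZη : ∫ ω, Z ω * η ω ∂P = 0 := by
    rw [eZ, integral_sub iZW (iZZ.const_mul c), integral_const_mul, hc,
      div_mul_cancel₀ _ hpos.ne', sub_self]
  have hWη := h η hηm ⟨_, hηN⟩ (fun ω hω => Set.indicator_of_notMem hω _) iZη hZη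
  have eη : (fun ω => η ω * η ω) = fun ω => W ω * η ω - c * (Z ω * η ω) := by
    ext ω
    by_cases hω : ω ∈ D
    · simp only [hη, Set.indicator_of_mem hω]
      ring
    · simp [hη, hω]
  have iηη : Integrable (fun ω => η ω * η ω) P := by
    rw [eη]
    exact iWη.sub (iZη.const_mul c)
  have hηη : ∫ ω, η ω * η ω ∂P = 0 := by
    rw [eη, integral_sub iWη (iZη.const_mul c), integral_const_mul, hWη, hZη]
    ring
  rw [integral_eq_zero_iff_of_nonneg (fun ω => mul_self_nonneg (η ω)) iηη] at hηη
  refine ⟨c, ?_⟩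
  filter_upwards [hηη] with ω hω hωD
  have h0 : η ω = 0 := mul_self_eq_zero.1 hω
  rw [hη, Set.indicator_of_mem hωD] at h0
  linarith

lemma hasDerivAt_F {p : Params} (hp : p.Standing) {y θ : ℝ} (hy : p.γ < y) :
    HasDerivAt (fun x => p.F x θ)
      (p.α * ((y - p.γ) ^ (p.α - 1) + θ * y ^ (p.α - 1))) y := by
  have h1 : HasDerivAt (fun x : ℝ => (x - p.γ) ^ p.α) (1 * p.α * (y - p.γ) ^ (p.α - 1)) y :=
    ((hasDerivAt_id y).sub_const p.γ).rpow_const (Or.inl (sub_pos.2 hy).ne')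
  have h2 : HasDerivAt (fun x : ℝ => x ^ p.α) (p.α * y ^ (p.α - 1)) y :=
    Real.hasDerivAt_rpow_const (Or.inl (hp.γ_pos.trans hy).ne')
  refine ((h1.add (h2.const_mul θ)).congr_of_eventuallyEq ?_).congr_deriv (by ring)
  filter_upwards [lt_mem_nhds hy] with x hx
  exact F_of_le hx.le

section Market

variable {Ω : Type*} [MeasurableSpace Ω] {P : Measure Ω} {B : ℝ≥0 → Ω → ℝ} {p : Params}
  [IsProbabilityMeasure P]

/-- The first-order condition for budget-neutral variations supported where the optimal return
exceeds the benchmark. -/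
lemma integral_deriv_mul_eq_zero [P.IsComplete] (hB : IsBrownianReal B P) (hp : p.Standing)
    {θ : ℝ} {Y : Ω → ℝ} (hY : Y ∈ argmaxSet p P B θ) {D : Set Ω} {c : ℝ} (hc : 0 < c)
    (hDY : ∀ ω ∈ D, p.γ + c ≤ Y ω) {η : Ω → ℝ} (hη : Measurable[augmentedSigma P B p.τ] η)
    {K : ℝ} (hηK : ∀ ω, |η ω| ≤ K) (hηD : ∀ ω ∉ D, η ω = 0)
    (hi : Integrable (fun ω => kernelZ p B p.τ ω * η ω) P)
    (h0 : ∫ ω, kernelZ p B p.τ ω * η ω ∂P = 0) :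
    ∫ ω, ((Y ω - p.γ) ^ (p.α - 1) + θ * Y ω ^ (p.α - 1)) * η ω ∂P = 0 := by
  have hle := augmentedSigma_le hB p.τ
  obtain ⟨hYm, hY0, hYi, hY1⟩ := (mem_returns_iff hB).1 hY.1
  have hYm' := measurable_of_mem_returns hB hY.1
  have hηm' : Measurable η := hη.mono hle le_rfl
  have hγ := hp.γ_pos
  have hα : p.α - 1 ≤ 0 := by linarith [hp.α_lt_one]
  -- Keeps the varied return above `γ + c/2` on `D`, away from the singular slope of the utility at
  -- the benchmark.
  set ε := c / (2 * (|K| + 1)) with hε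
  have hK1 : 0 < |K| + 1 := by positivity
  have hε0 : 0 < ε := by positivity
  have hsmall : ∀ x ∈ Metric.ball (0 : ℝ) ε, ∀ ω, |x * η ω| ≤ c / 2 := by
    intro x hx ω
    rw [Metric.mem_ball, dist_zero_right, Real.norm_eq_abs] at hx
    rw [abs_mul]
    have h2 : |η ω| ≤ |K| + 1 := (hηK ω).trans ((le_abs_self K).trans (by linarith))
    refine (mul_le_mul hx.le h2 (abs_nonneg _) hε0.le).trans (le_of_eq ?_)
    rw [hε]
    field_simp
  have habove : ∀ x ∈ Metric.ball (0 : ℝ) ε, ∀ ω ∈ D, p.γ + c / 2 ≤ Y ω + x * η ω := by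
    intro x hx ω hω
    have h1 := neg_le_of_abs_le (hsmall x hx ω)
    have h2 := hDY ω hω
    linarith
  have hmem : ∀ x ∈ Metric.ball (0 : ℝ) ε, (fun ω => Y ω + x * η ω) ∈ returns p P B := by
    intro x hx
    have e : (fun ω => kernelZ p B p.τ ω * (Y ω + x * η ω)) =
        fun ω => kernelZ p B p.τ ω * Y ω + x * (kernelZ p B p.τ ω * η ω) := by
      ext ω
      ring
    refine (mem_returns_iff hB).2 ⟨hYm.add (hη.const_mul x), fun ω => ?_, ?_, ?_⟩
    · by_cases hω : ω ∈ D
      · have := habove x hx ω hω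
        linarith
      · rw [hηD ω hω, mul_zero, add_zero]
        exact hY0 ω
    · rw [e]
      exact hYi.add (hi.const_mul x)
    · rw [e, integral_add hYi (hi.const_mul x), integral_const_mul, h0]
      linarith
  set F' : ℝ → Ω → ℝ := fun x ω =>
    p.α * ((Y ω + x * η ω - p.γ) ^ (p.α - 1) + θ * (Y ω + x * η ω) ^ (p.α - 1)) * η ω with hF'
  have hderiv := hasDerivAt_integral_of_dominated_loc_of_deriv_le
    (μ := P) (F := fun x ω => p.F (Y ω + x * η ω) θ) (F' := F') (x₀ := (0 : ℝ))
    (bound := fun _ => p.α * ((c / 2) ^ (p.α - 1) + |θ| * p.γ ^ (p.α - 1)) * |K|)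
    (Metric.ball_mem_nhds 0 hε0)
    (Filter.Eventually.of_forall fun x =>
      ((measurable_F θ).comp (hYm'.add (hηm'.const_mul x))).aestronglyMeasurable)
    (by simpa using integrable_F hB hp hY.1 θ)
    (by
      refine Measurable.aestronglyMeasurable ?_
      simp only [hF']
      fun_prop)
    (ae_of_all _ fun ω x hx => by
      by_cases hω : ω ∈ D
      · have h1 := habove x hx ω hω
        have a1 : (Y ω + x * η ω - p.γ) ^ (p.α - 1) ≤ (c / 2) ^ (p.α - 1) :=
          Real.rpow_le_rpow_of_nonpos (by positivity) (by linarith) hα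
        have a2 : (Y ω + x * η ω) ^ (p.α - 1) ≤ p.γ ^ (p.α - 1) :=
          Real.rpow_le_rpow_of_nonpos hγ (by linarith) hα
        have n1 : 0 ≤ (Y ω + x * η ω - p.γ) ^ (p.α - 1) := Real.rpow_nonneg (by linarith) _
        have n2 : 0 ≤ (Y ω + x * η ω) ^ (p.α - 1) := Real.rpow_nonneg (by linarith) _
        rw [hF', Real.norm_eq_abs, abs_mul, abs_mul, abs_of_pos hp.α_pos]
        refine mul_le_mul (mul_le_mul_of_nonneg_left ?_ hp.α_pos.le)
          ((hηK ω).trans (le_abs_self K)) (abs_nonneg _)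
          (mul_nonneg hp.α_pos.le (by positivity))
        refine (abs_add_le _ _).trans (add_le_add ?_ ?_)
        · rwa [abs_of_nonneg n1]
        · rw [abs_mul, abs_of_nonneg n2]
          exact mul_le_mul_of_nonneg_left a2 (abs_nonneg θ)
      · simp only [hF', hηD ω hω, mul_zero, norm_zero]
        have := hp.α_pos
        positivity)
    (integrable_const _)
    (ae_of_all _ fun ω x hx => by
      by_cases hω : ω ∈ D
      · have h1 := habove x hx ω hω
        have hd := hasDerivAt_F (θ := θ) hp (show p.γ < Y ω + x * η ω by linarith)
        have hin : HasDerivAt (fun x => Y ω + x * η ω) (η ω) x := by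
          simpa using ((hasDerivAt_id x).mul_const (η ω)).const_add (Y ω)
        exact hd.comp x hin
      · simp only [hF', hηD ω hω, mul_zero, add_zero]
        exact hasDerivAt_const x _)
  have hmax : IsLocalMax (fun x => ∫ ω, p.F (Y ω + x * η ω) θ ∂P) 0 := by
    filter_upwards [Metric.ball_mem_nhds (0 : ℝ) hε0] with x hx
    have := hY.2 (hmem x hx)
    simpa [objective] using this
  have hzero := hmax.hasDerivAt_eq_zero hderiv.2
  simp only [hF', zero_mul, add_zero, mul_assoc] at hzero
  rw [integral_const_mul] at hzero
  simpa using (mul_eq_zero.1 hzero).resolve_left hp.α_pos.ne'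

/-- A return that exceeds the benchmark with positive probability is optimal for at most one
continuation weight. -/
lemma eq_of_mem_argmaxSet [P.IsComplete] (hB : IsBrownianReal B P) (hp : p.Standing)
    {θ₁ θ₂ : ℝ} {Y : Ω → ℝ} (hY₁ : Y ∈ argmaxSet p P B θ₁)
    (hY₂ : Y ∈ argmaxSet p P B θ₂) (hpos : 0 < P {ω | p.γ < Y ω}) : θ₁ = θ₂ := by
  by_contra hne
  have hγ := hp.γ_pos
  have hα : p.α - 1 < 0 := by linarith [hp.α_lt_one]
  have hle := augmentedSigma_le hB p.τ
  have hZm : Measurable[augmentedSigma P B p.τ] (kernelZ p B p.τ) :=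
    kernelZ_measurable_augmentedSigma p.τ
  have hYm := hY₁.1.1
  -- The truncation makes `Z` and both marginal utilities bounded on `D n`.
  set D : ℕ → Set Ω := fun n => {ω | p.γ + 1 / ((n : ℝ) + 1) ≤ Y ω} ∩
    {ω | kernelZ p B p.τ ω ≤ n} with hD
  have hDm : ∀ n, MeasurableSet[augmentedSigma P B p.τ] (D n) := fun n =>
    MeasurableSet.inter (hYm measurableSet_Ici) (hZm measurableSet_Iic)
  obtain ⟨n, hn⟩ : ∃ n, P (D n) ≠ 0 := by
    by_contra! hc
    refine hpos.ne' (measure_mono_null (fun ω hω => ?_) (measure_iUnion_null hc))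
    obtain ⟨n₁, hn₁⟩ := exists_nat_one_div_lt (sub_pos.2 (show p.γ < Y ω from hω))
    obtain ⟨n₂, hn₂⟩ := exists_nat_gt (kernelZ p B p.τ ω)
    have e1 : (n₁ : ℝ) ≤ (max n₁ n₂ : ℕ) := by exact_mod_cast le_max_left _ _
    have e2 : (n₂ : ℝ) ≤ (max n₁ n₂ : ℕ) := by exact_mod_cast le_max_right _ _
    refine Set.mem_iUnion.2 ⟨max n₁ n₂, ?_, hn₂.le.trans e2⟩
    have : 1 / (((max n₁ n₂ : ℕ) : ℝ) + 1) ≤ 1 / ((n₁ : ℝ) + 1) :=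
      one_div_le_one_div_of_le (by positivity) (by linarith)
    change p.γ + 1 / (((max n₁ n₂ : ℕ) : ℝ) + 1) ≤ Y ω
    linarith
  have hc : (0 : ℝ) < 1 / ((n : ℝ) + 1) := by positivity
  set c : ℝ := 1 / ((n : ℝ) + 1) with hcdef
  have hDY : ∀ ω ∈ D n, p.γ + c ≤ Y ω := fun ω hω => hω.1
  have hV : ∀ ω ∈ D n, 0 ≤ (Y ω - p.γ) ^ (p.α - 1) ∧
      (Y ω - p.γ) ^ (p.α - 1) ≤ c ^ (p.α - 1) := fun ω hω => by
    have := hDY ω hω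
    exact ⟨Real.rpow_nonneg (by linarith) _,
      Real.rpow_le_rpow_of_nonpos hc (by linarith) hα.le⟩
  have hW : ∀ ω ∈ D n, 0 ≤ Y ω ^ (p.α - 1) ∧ Y ω ^ (p.α - 1) ≤ p.γ ^ (p.α - 1) :=
    fun ω hω => by
      have := hDY ω hω
      exact ⟨Real.rpow_nonneg (by linarith) _,
        Real.rpow_le_rpow_of_nonpos hγ (by linarith) hα.le⟩
  set N : ℝ := n + (c ^ (p.α - 1) + p.γ ^ (p.α - 1)) with hN
  have b1 : 0 ≤ c ^ (p.α - 1) := Real.rpow_nonneg hc.le _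
  have b2 : 0 ≤ p.γ ^ (p.α - 1) := Real.rpow_nonneg hγ.le _
  have b3 : (0 : ℝ) ≤ n := n.cast_nonneg
  have hZN : ∀ ω ∈ D n, |kernelZ p B p.τ ω| ≤ N := fun ω hω => by
    rw [abs_of_pos (kernelZ_pos _ _)]
    have : kernelZ p B p.τ ω ≤ n := hω.2
    linarith
  have hVN : ∀ ω ∈ D n, |(Y ω - p.γ) ^ (p.α - 1)| ≤ N := fun ω hω => by
    rw [abs_of_nonneg (hV ω hω).1]
    linarith [(hV ω hω).2]
  have hWN : ∀ ω ∈ D n, |Y ω ^ (p.α - 1)| ≤ N := fun ω hω => by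
    rw [abs_of_nonneg (hW ω hω).1]
    linarith [(hW ω hω).2]
  have hVm : Measurable[augmentedSigma P B p.τ] fun ω => (Y ω - p.γ) ^ (p.α - 1) :=
    (hYm.sub_const _).pow_const _
  have hWm : Measurable[augmentedSigma P B p.τ] fun ω => Y ω ^ (p.α - 1) := hYm.pow_const _
  have horth : ∀ η : Ω → ℝ, Measurable[augmentedSigma P B p.τ] η → (∃ K, ∀ ω, |η ω| ≤ K) →
      (∀ ω ∉ D n, η ω = 0) → Integrable (fun ω => kernelZ p B p.τ ω * η ω) P →
      ∫ ω, kernelZ p B p.τ ω * η ω ∂P = 0 →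
      ∫ ω, (Y ω - p.γ) ^ (p.α - 1) * η ω ∂P = 0 ∧ ∫ ω, Y ω ^ (p.α - 1) * η ω ∂P = 0 := by
    rintro η hη ⟨K, hK⟩ hηD hi h0
    have hint : ∀ f : Ω → ℝ, Measurable[augmentedSigma P B p.τ] f → (∀ ω ∈ D n, |f ω| ≤ N) →
        Integrable (fun ω => f ω * η ω) P := by
      intro f hf hfN
      refine Integrable.mono' (integrable_const (|N| * |K|))
        ((hf.mul hη).mono hle le_rfl).aestronglyMeasurable (ae_of_all _ fun ω => ?_)
      by_cases hω : ω ∈ D n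
      · rw [norm_mul]
        exact mul_le_mul ((hfN ω hω).trans (le_abs_self N)) ((hK ω).trans (le_abs_self K))
          (abs_nonneg _) (abs_nonneg _)
      · rw [hηD ω hω, mul_zero, norm_zero]
        positivity
    have iV := hint _ hVm hVN
    have iW := hint _ hWm hWN
    have hfoc : ∀ θ, Y ∈ argmaxSet p P B θ → ∫ ω, (Y ω - p.γ) ^ (p.α - 1) * η ω ∂P
        + θ * ∫ ω, Y ω ^ (p.α - 1) * η ω ∂P = 0 := by
      intro θ hYθ
      have h := integral_deriv_mul_eq_zero hB hp hYθ hc hDY hη hK hηD hi h0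
      rw [← integral_const_mul, ← integral_add iV (iW.const_mul θ), ← h]
      congr 1
      ext ω
      ring
    have f1 := hfoc _ hY₁
    have f2 := hfoc _ hY₂
    -- Subtracting the conditions for `θ₁ ≠ θ₂` separates the two marginal utilities.
    have hW0 : ∫ ω, Y ω ^ (p.α - 1) * η ω ∂P = 0 := by
      have : (θ₁ - θ₂) * ∫ ω, Y ω ^ (p.α - 1) * η ω ∂P = 0 := by linarith
      exact (mul_eq_zero.1 this).resolve_left (sub_ne_zero.2 hne)
    refine ⟨?_, hW0⟩
    rw [hW0, mul_zero, add_zero] at f1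
    exact f1
  obtain ⟨a, ha⟩ := exists_ae_eq_const_mul_of_orthogonal hle hZm hVm (kernelZ_pos p.τ) (hDm n)
    hn hZN hVN fun η h1 h2 h3 h4 h5 => (horth η h1 h2 h3 h4 h5).1
  obtain ⟨b, hb⟩ := exists_ae_eq_const_mul_of_orthogonal hle hZm hWm (kernelZ_pos p.τ) (hDm n)
    hn hZN hWN fun η h1 h2 h3 h4 h5 => (horth η h1 h2 h3 h4 h5).2
  -- Both marginal utilities are multiples of `Z`, so their ratio fixes `(Y-γ)/Y`, then `Y`, then
  -- `Z`.
  have hconst : ∀ᵐ ω ∂P, ω ∈ D n →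
      kernelZ p B p.τ ω = (p.γ / (1 - (a / b) ^ (1 / (p.α - 1)))) ^ (p.α - 1) / b := by
    filter_upwards [ha, hb] with ω h1 h2 hω
    specialize h1 hω
    specialize h2 hω
    have hYγ : 0 < Y ω - p.γ := by linarith [hDY ω hω]
    have hY0 : 0 < Y ω := by linarith
    have hZ0 : 0 < kernelZ p B p.τ ω := kernelZ_pos _ _
    have hb0 : b ≠ 0 := by
      rintro rfl
      rw [zero_mul] at h2
      exact (Real.rpow_pos_of_pos hY0 _).ne' h2
    have hratio : ((Y ω - p.γ) / Y ω) ^ (p.α - 1) = a / b := by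
      rw [Real.div_rpow hYγ.le hY0.le, h1, h2]
      field_simp
    have hr : (a / b) ^ (1 / (p.α - 1)) = (Y ω - p.γ) / Y ω := by
      rw [← hratio, ← Real.rpow_mul (by positivity), mul_one_div_cancel hα.ne, Real.rpow_one]
    have hYeq : p.γ / (1 - (a / b) ^ (1 / (p.α - 1))) = Y ω := by
      rw [hr]
      have : 1 - (Y ω - p.γ) / Y ω = p.γ / Y ω := by
        field_simp
        ring
      rw [this]
      field_simp
    rw [hYeq, h2]
    field_simp
  refine hn (measure_mono_null_ae ?_ (measure_kernelZ_eq hB hp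
    ((p.γ / (1 - (a / b) ^ (1 / (p.α - 1)))) ^ (p.α - 1) / b)))
  filter_upwards [hconst] with ω hω hωD
  exact hω hωD

/-! ### Subgradients and comparison of the constants. -/

/-- `E[Y ^ α]` is a subgradient of the value function at every weight for which `Y` is optimal. -/
lemma Phi_add_le_of_mem_argmaxSet [P.IsComplete] (hB : IsBrownianReal B P) (hp : p.Standing)
    {θ : ℝ} {Y : Ω → ℝ} (hY : Y ∈ argmaxSet p P B θ) (θ' : ℝ) :
    Phi p P B θ + (θ' - θ) * ∫ ω, Y ω ^ p.α ∂P ≤ Phi p P B θ' := by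
  rw [← ((mem_argmaxSet_iff hB hp).1 hY).2]
  have h := objective_le_Phi hB hp hY.1 θ'
  rw [objective_eq hB hp hY.1] at h ⊢
  linarith

/-- The subgradient inequality is strict above the threshold. -/
lemma Phi_add_lt_of_mem_argmaxSet [P.IsComplete] (hB : IsBrownianReal B P) (hp : p.Standing)
    {θ : ℝ} (hθ : p.thetaLow < θ) {Y : Ω → ℝ} (hY : Y ∈ argmaxSet p P B θ) {θ' : ℝ}
    (hne : θ ≠ θ') :
    Phi p P B θ + (θ' - θ) * ∫ ω, Y ω ^ p.α ∂P < Phi p P B θ' := by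
  -- Equality would make `Y` optimal at `θ'` as well.
  refine (Phi_add_le_of_mem_argmaxSet hB hp hY θ').lt_of_ne fun heq => hne ?_
  refine eq_of_mem_argmaxSet hB hp hY ((mem_argmaxSet_iff hB hp).2 ⟨hY.1, ?_⟩)
    (measure_gt_pos_of_mem_argmaxSet hB hp hθ hY)
  have h := ((mem_argmaxSet_iff hB hp).1 hY).2
  rw [objective_eq hB hp hY.1] at h ⊢
  linarith

lemma thetaLow_neg (hp : p.Standing) : p.thetaLow < 0 :=
  neg_lt_zero.2 (Real.rpow_pos_of_pos
    (add_pos_of_pos_of_nonneg one_pos (Real.rpow_nonneg hp.k_nonneg _)) _)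

lemma discount_mul_mem_Ico (hp : p.Standing) {ξ : ℝ}
    (hξ : ξ ∈ Set.Icc 0 (Real.exp (p.h * p.τ))) :
    Real.exp (-p.δ * p.τ) * ξ ∈ Set.Ico (0 : ℝ) 1 :=
  ⟨mul_nonneg (Real.exp_pos _).le hξ.1,
    (mul_le_mul_of_nonneg_left hξ.2 (Real.exp_pos _).le).trans_lt (exp_discount_lt_one hp)⟩

lemma kappa_mem_Ioo (hp : p.Standing) {β : ℝ} (hβ : β ∈ Set.Ioo (0 : ℝ) 1) {ξ : ℝ}
    (hξ : ξ ∈ Set.Icc 0 (Real.exp (p.h * p.τ))) : kappa p β ξ ∈ Set.Ioo (0 : ℝ) 1 := by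
  obtain ⟨-, h1⟩ := discount_mul_mem_Ico hp hξ
  have h2 := mul_lt_mul_of_pos_left h1 (sub_pos.2 hβ.2)
  have h3 : β < 1 - (1 - β) * Real.exp (-p.δ * p.τ) * ξ := by
    rw [mul_assoc]
    linarith
  exact ⟨div_pos hβ.1 (hβ.1.trans h3), (div_lt_one (hβ.1.trans h3)).2 h3⟩

lemma Amy_eq [P.IsComplete] (hB : IsBrownianReal B P) (hp : p.Standing) :
    Amy p P B = Real.exp (-p.δ * p.τ) * Phi p P B 0 := by
  have h := thetaStar_eq hB hp le_rfl zero_le_one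
  rw [zero_mul] at h
  exact h.symm

lemma Aexpo_eq [P.IsComplete] (hB : IsBrownianReal B P) (hp : p.Standing) :
    Aexpo p P B = Real.exp (-p.δ * p.τ) * Phi p P B (Aexpo p P B) := by
  have h := thetaStar_eq hB hp zero_le_one le_rfl
  rw [one_mul] at h
  exact h.symm

lemma lt_Aexpo_iff [P.IsComplete] (hB : IsBrownianReal B P) (hp : p.Standing) {x : ℝ} :
    x < Aexpo p P B ↔ x < Real.exp (-p.δ * p.τ) * Phi p P B x := by
  have h := Aexpo_eq hB hp
  rcases lt_trichotomy x (Aexpo p P B) with hx | hx | hx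
  · have := discounted_Phi_sub_lt hB hp hx
    exact iff_of_true hx (by linarith)
  · rw [hx]
    exact iff_of_false (lt_irrefl _) h.not_lt
  · have := discounted_Phi_sub_lt hB hp hx
    exact iff_of_false hx.not_gt (by linarith)

lemma le_Aexpo_iff [P.IsComplete] (hB : IsBrownianReal B P) (hp : p.Standing) {x : ℝ} :
    x ≤ Aexpo p P B ↔ x ≤ Real.exp (-p.δ * p.τ) * Phi p P B x := by
  have h := Aexpo_eq hB hp
  rcases lt_trichotomy x (Aexpo p P B) with hx | hx | hx
  · exact iff_of_true hx.le ((lt_Aexpo_iff hB hp).1 hx).le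
  · rw [hx]
    exact iff_of_true le_rfl h.le
  · have := discounted_Phi_sub_lt hB hp hx
    exact iff_of_false hx.not_ge (by linarith)

lemma Aso_eq [P.IsComplete] (hB : IsBrownianReal B P) (hp : p.Standing) {β : ℝ}
    (hβ : β ∈ Set.Ioo (0 : ℝ) 1) {ξ : ℝ} (hξ : ξ ∈ Set.Icc 0 (Real.exp (p.h * p.τ))) :
    Aso p P B β ξ = kappa p β ξ * (Real.exp (-p.δ * p.τ) * Phi p P B (Aso p P B β ξ)) := by
  have hκ := kappa_mem_Ioo hp hβ hξ
  have h := thetaStar_eq hB hp hκ.1.le hκ.2.le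
  conv_lhs => rw [Aso, ← h]
  rfl

/-- The equilibrium equation of the sophisticated agent in linearized form. -/
lemma Aso_div_eq [P.IsComplete] (hB : IsBrownianReal B P) (hp : p.Standing) {β : ℝ}
    (hβ : β ∈ Set.Ioo (0 : ℝ) 1) {ξ : ℝ} (hξ : ξ ∈ Set.Icc 0 (Real.exp (p.h * p.τ))) :
    Aso p P B β ξ / β = Real.exp (-p.δ * p.τ) *
      (Phi p P B (Aso p P B β ξ) + (Aso p P B β ξ / β - Aso p P B β ξ) * ξ) := by
  have h := Aso_eq hB hp hβ hξ
  have hβ0 := hβ.1.ne'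
  -- A vanishing denominator would give `κ` the default value `0`, contrary to `κ > 0`.
  have hden : 1 - (1 - β) * Real.exp (-p.δ * p.τ) * ξ ≠ 0 := by
    intro h0
    have hκ := (kappa_mem_Ioo hp hβ hξ).1
    rw [kappa, h0, div_zero] at hκ
    exact hκ.false
  generalize Aso p P B β ξ = A at *
  rw [kappa, div_mul_eq_mul_div, eq_div_iff hden] at h
  generalize Real.exp (-p.δ * p.τ) = a at *
  field_simp
  linarith

/-- A solution of `A = κ e ^ (-δτ) Φ(A)` has the sign of `A_my`. -/
lemma sign_of_eq_kappa_mul [P.IsComplete] (hB : IsBrownianReal B P) (hp : p.Standing) {κ A : ℝ}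
    (h0 : 0 < κ) (h1 : κ < 1) (hA : A = κ * (Real.exp (-p.δ * p.τ) * Phi p P B A)) :
    (0 < Amy p P B → 0 < A) ∧ (Amy p P B < 0 → A < 0) ∧ (Amy p P B = 0 → A = 0) := by
  rw [Amy_eq hB hp]
  set a := Real.exp (-p.δ * p.τ) with ha
  -- Since `κ < 1`, `aΦ(A) = A/κ ≤ A` for negative `A`, and strict contraction gives `aΦ(0) < aΦ(A)
  -- - A ≤ 0`.
  have hneg : A < 0 → a * Phi p P B 0 < 0 := by
    intro h
    have h2 := discounted_Phi_sub_lt hB hp h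
    have h3 : a * Phi p P B A ≤ A := by nlinarith
    linarith
  have hpos : 0 < A → 0 < a * Phi p P B 0 := by
    intro h
    have h2 := discounted_Phi_sub_lt hB hp h
    have h3 : A ≤ a * Phi p P B A := by nlinarith
    linarith
  have hzero : A = 0 → a * Phi p P B 0 = 0 := by
    intro h
    rw [h] at hA
    exact (mul_eq_zero.1 hA.symm).resolve_left h0.ne'
  rcases lt_trichotomy A 0 with h | h | h
  · have := hneg h
    exact ⟨fun _ => by linarith, fun _ => h, fun _ => by linarith⟩
  · have := hzero h
    exact ⟨fun _ => by linarith, fun _ => by linarith, fun _ => h⟩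
  · have := hpos h
    exact ⟨fun _ => h, fun _ => by linarith, fun _ => by linarith⟩

end Market

end PeriodicPortfolio

open PeriodicPortfolio in
theorem mainTheorem7 {Ω : Type*} [MeasurableSpace Ω]
    (P : Measure Ω) [IsProbabilityMeasure P] [P.IsComplete]
    (B : ℝ≥0 → Ω → ℝ) (hB : IsBrownianReal B P)
    (p : PeriodicPortfolio.Params) (hp : p.Standing)
    (β : ℝ) (hβ : β ∈ Set.Ioo (0 : ℝ) 1)
    (ξ : ℝ) (hξ : ξ ∈ Set.Icc 0 (Real.exp (p.h * p.τ)))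
    (hfix : ξ ∈ PeriodicPortfolio.mapG p P B β ξ) :
    (PeriodicPortfolio.Amy p P B = 0 →
      β * PeriodicPortfolio.Aexpo p P B = 0 ∧
      PeriodicPortfolio.Aexpo p P B = 0 ∧
      PeriodicPortfolio.Aso p P B β ξ = 0) ∧
    (0 < PeriodicPortfolio.Amy p P B →
      0 < PeriodicPortfolio.Aso p P B β ξ ∧
      PeriodicPortfolio.Aso p P B β ξ < β * PeriodicPortfolio.Aexpo p P B ∧
      β * PeriodicPortfolio.Aexpo p P B < PeriodicPortfolio.Aexpo p P B ∧
      PeriodicPortfolio.betaHat p P B β ξ ∈ Set.Ioo 0 β) ∧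
    (PeriodicPortfolio.Amy p P B < 0 →
      PeriodicPortfolio.Aexpo p P B < PeriodicPortfolio.Aso p P B β ξ ∧
      PeriodicPortfolio.Aso p P B β ξ ≤ β * PeriodicPortfolio.Aexpo p P B ∧
      β * PeriodicPortfolio.Aexpo p P B < 0 ∧
      PeriodicPortfolio.betaHat p P B β ξ ∈ Set.Ico β 1 ∧
      (p.thetaLow ≤ PeriodicPortfolio.Aexpo p P B →
        PeriodicPortfolio.Aso p P B β ξ < β * PeriodicPortfolio.Aexpo p P B ∧
        β < PeriodicPortfolio.betaHat p P B β ξ)) := by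
  obtain ⟨Y, hY, hYξ⟩ := hfix
  have hYξ' : ∫ ω, Y ω ^ p.α ∂P = ξ := hYξ
  change Y ∈ argmaxSet p P B (Aso p P B β ξ) at hY
  have hκ := kappa_mem_Ioo hp hβ hξ
  have hAso := Aso_eq hB hp hβ hξ
  have hdiv := Aso_div_eq hB hp hβ hξ
  obtain ⟨hspos, hsneg, hszero⟩ := sign_of_eq_kappa_mul hB hp hκ.1 hκ.2 hAso
  have hle : Aso p P B β ξ ≤ β * Aexpo p P B := by
    have h := Phi_add_le_of_mem_argmaxSet hB hp hY (Aso p P B β ξ / β)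
    rw [hYξ'] at h
    rw [mul_comm, ← div_le_iff₀ hβ.1, le_Aexpo_iff hB hp]
    exact hdiv.le.trans (mul_le_mul_of_nonneg_left h (Real.exp_pos _).le)
  have hlt : Aso p P B β ξ ≠ 0 → p.thetaLow < Aso p P B β ξ →
      Aso p P B β ξ < β * Aexpo p P B := by
    intro h0 hθ
    have hne : Aso p P B β ξ ≠ Aso p P B β ξ / β := by
      rw [Ne, eq_div_iff hβ.1.ne', mul_eq_left₀ h0]
      exact hβ.2.ne
    have h := Phi_add_lt_of_mem_argmaxSet hB hp hθ hY hne
    rw [hYξ'] at h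
    rw [mul_comm, ← div_lt_iff₀ hβ.1, lt_Aexpo_iff hB hp]
    exact hdiv.trans_lt (mul_lt_mul_of_pos_left h (Real.exp_pos _))
  refine ⟨fun h => ?_, fun h => ?_, fun h => ?_⟩
  · have h0 : Aexpo p P B = 0 := by
      rw [Amy_eq hB hp] at h
      refine le_antisymm (not_lt.1 fun h' => ?_) ((le_Aexpo_iff hB hp).2 h.ge)
      exact h.not_gt ((lt_Aexpo_iff hB hp).1 h')
    exact ⟨by rw [h0, mul_zero], h0, hszero h⟩
  · have hA := hspos h
    have hE : 0 < Aexpo p P B := by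
      rw [lt_Aexpo_iff hB hp, ← Amy_eq hB hp]
      exact h
    have hlt' := hlt hA.ne' ((thetaLow_neg hp).trans hA)
    exact ⟨hA, hlt', mul_lt_of_lt_one_left hE hβ.2, div_pos hA hE, (div_lt_iff₀ hE).2 hlt'⟩
  · have hA := hsneg h
    have hE : Aexpo p P B < 0 := by
      rw [← not_le, le_Aexpo_iff hB hp, ← Amy_eq hB hp, not_le]
      exact h
    -- Here `aΦ(A_so) = A_so/κ < A_so`, because `A_so < 0` and `κ < 1`.
    have hEA : Aexpo p P B < Aso p P B β ξ := by
      rw [← not_le, le_Aexpo_iff hB hp, not_le]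
      nlinarith [hκ.1, hκ.2]
    refine ⟨hEA, hle, mul_neg_of_pos_of_neg hβ.1 hE, ⟨(le_div_iff_of_neg hE).2 hle,
      (div_lt_one_of_neg hE).2 hEA⟩, fun hθ => ?_⟩
    -- `A_expo < A_so` turns the weak threshold assumption on `A_expo` into the strict one needed at
    -- `A_so`.
    have hlt' := hlt hA.ne (hθ.trans_lt hEA)
    exact ⟨hlt', (lt_div_iff_of_neg hE).2 hlt'⟩
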